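/- **Setting.** Let $n\ge 1$ and let $\mathbb{CH}^{n-1}$ be complex hyperbolic space of complex dimension $n-1$, with complex structure $J$ and metric $\mathfrak c_{n-1}$ normalized to have constant holomorphic sectional curvature $-4$. Let $X=\mathbb{CH}^{n-1}\times\mathbb S^1\times(0,\infty)$ with coordinates $(p,\theta,r)$. For a smooth $1$-form $\alpha$ on $\mathbb{CH}^{n-1}$, call $\ker(d\theta+\alpha)\cap\ker(dr)$ the horizontal distribution, and let $\mu_\alpha$ be the Riemannian metric on $X$ $$\mu_\alpha=\cosh^2(r)\,\mathfrak c_{n-1}+\tfrac14\sinh^2(2r)\,(d\theta+\alpha)^2+dr^2 .$$ (This is $\mu=h^2\mathfrak c_{n-1}+\frac14v^2d\theta^2+dr^2$ with $h=\cosh r$, $v=\sinh 2r$, where $d\theta$ is read as the coframe that is dual to $\partial/\partial\theta$ and vanishes on the horizontal distribution.) A holomorphic frame near $p\in\mathbb{CH}^{n-1}$ is a smooth local $\mathfrak c_{n-1}$-orthonormal frame $(\check X_1,\dots,\check X_{2n-2})$ with $\check X_{i+1}=J\check X_i$ for $i$ odd and $[\check X_i,\check X_j]_p=0$ for all $i,j$.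 Let $X_i=\check X_i-\alpha(\check X_i)\,\partial/\partial\theta$ be its horizontal lift, which is invariant under $\theta$ and $r$. We say that $\mu_\alpha$ has structure constants $c_i$ ($i$ odd) at $q=(p,\theta,r)$ with respect to this frame if at $q$ $$[X_i,X_{i+1}]=c_i\,\frac{\partial}{\partial\theta}\ \ (i\text{ odd}),\qquad [X_i,X_j]=0\ \text{ if }\{X_i,X_j\}\text{ is not one of the pairs }\{X_k,X_{k+1}\},\ k\text{ odd, and } i\neq j,$$ and the $\partial/\partial\theta$-components $(d\theta+\alpha)([X_i,X_j])$ of all brackets are constant to first order at $q$, that is, their differentials vanish at $q$ (for instance, they are constant near $q$). The $c_i$ are otherwise arbitrary real numbers, possibly different from each other. **Lemma 2.3.** Let $n\ge1$. For every $\varepsilon>0$ there exist $R>0$ and $\eta>0$ (depending only on $n$ and $\varepsilon$) such that the following holds. Let $\alpha$ be any smooth $1$-form on $\mathbb{CH}^{n-1}$, let $q=(p,\theta,r)\in X$ with $r>R$, and suppose that with respect to some holomorphic frame near $p$ the metric $\mu_\alpha$ has structure constants $c_i$ at $q$ with $c_i\in(-2-\eta,2+\eta)$ for all odd $i$. Then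 every $2$-plane $\sigma\subseteq T_qX$ has sectional curvature $$K_{\mu_\alpha}(\sigma)\in(-4-\varepsilon,\,-1+\varepsilon).$$ -/

import Mathlib

open scoped ContDiff Topology

noncomputable section

namespace PinchedCurvature

/-! ### Riemannian curvature in coordinates

A Riemannian metric on an open subset of a finite-dimensional real vector space `V` is given by its
metric tensor `g : V → V →L[ℝ] V →L[ℝ] ℝ` (only the values near the point in question matter). -/

section Riemannian

variable {V : Type*} [NormedAddCommGroup V] [NormedSpace ℝ V]

/-- The Christoffel symbol of the first kind (Koszul formula), as a covector:
`w ↦ (D_u g (v, w) + D_v g (u, w) - D_w g (u, v)) / 2` at `x`. -/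
def christoffelLower (g : V → V →L[ℝ] V →L[ℝ] ℝ) (x u v : V) : V →L[ℝ] ℝ :=
  (1 / 2 : ℝ) •
    (fderiv ℝ g x u v + fderiv ℝ g x v u - ((fderiv ℝ g x).flip u).flip v)

/-- The Christoffel symbol `Γ_x(u, v)` of the Levi-Civita connection: the vector which represents
the covector `christoffelLower g x u v` with respect to `g x`.  In other words,
`∇_U W = D_U W + Γ(U, W)`. -/
def christoffel (g : V → V →L[ℝ] V →L[ℝ] ℝ) (x u v : V) : V :=
  (g x).inverse (christoffelLower g x u v)

/-- The Riemann curvature tensor `R(u, v) w = ∇_u ∇_v w - ∇_v ∇_u w - ∇_[u, v] w` at `x`. -/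
def riemann (g : V → V →L[ℝ] V →L[ℝ] ℝ) (x u v w : V) : V :=
  fderiv ℝ (fun y ↦ christoffel g y v w) x u - fderiv ℝ (fun y ↦ christoffel g y u w) x v
    + christoffel g x u (christoffel g x v w) - christoffel g x v (christoffel g x u w)

/-- The sectional curvature at `x` of the plane spanned by `u` and `v` (linearly independent):
`K = g(R(u, v) v, u) / (g(u, u) g(v, v) - g(u, v)²)`. -/
def sectionalCurvature (g : V → V →L[ℝ] V →L[ℝ] ℝ) (x u v : V) : ℝ :=
  g x (riemann g x u v v) u / (g x u u * g x v v - g x u v ^ 2)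

end Riemannian

/-! ### Complex hyperbolic space -/

/-- `ℂᵐ`; complex hyperbolic space `ℂℍᵐ` is its open unit ball. -/
abbrev Cn (m : ℕ) : Type := EuclideanSpace ℂ (Fin m)

/-- The real-linear functional `u ↦ Re ⟪z, u⟫`. -/
def reInner {m : ℕ} (z : Cn m) : Cn m →L[ℝ] ℝ :=
  Complex.reCLM ∘L (innerSL ℂ z).restrictScalars ℝ

/-- The real-linear functional `u ↦ Im ⟪z, u⟫`. -/
def imInner {m : ℕ} (z : Cn m) : Cn m →L[ℝ] ℝ :=
  Complex.imCLM ∘L (innerSL ℂ z).restrictScalars ℝ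

/-- The Euclidean metric `Re ⟪u, w⟫` of `ℂᵐ`. -/
def euclideanMetric (m : ℕ) : Cn m →L[ℝ] Cn m →L[ℝ] ℝ :=
  LinearMap.mkContinuous₂
    (LinearMap.mk₂ ℝ (fun u w : Cn m ↦ (inner ℂ u w).re)
      (fun u v w ↦ by simp)
      (fun c u w ↦ by simp [inner_smul_left_eq_smul])
      (fun u v w ↦ by simp)
      (fun c u w ↦ by simp [inner_smul_right_eq_smul]))
    1 (fun u w ↦ by
      simpa using (Complex.abs_re_le_norm _).trans (norm_inner_le_norm (𝕜 := ℂ) u w))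

/-- The complex hyperbolic metric `𝔠_m` on the unit ball of `ℂᵐ` (the Bergman metric), normalized
to have constant holomorphic sectional curvature `-4`; see `chMetric_apply`. -/
def chMetric {m : ℕ} (z : Cn m) : Cn m →L[ℝ] Cn m →L[ℝ] ℝ :=
  (1 / (1 - ‖z‖ ^ 2)) • euclideanMetric m
    + (1 / (1 - ‖z‖ ^ 2) ^ 2) •
      ((reInner z).smulRight (reInner z) + (imInner z).smulRight (imInner z))

theorem chMetric_apply {m : ℕ} (z u w : Cn m) :
    chMetric z u w = (inner ℂ u w / (1 - ‖z‖ ^ 2)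
      + inner ℂ u z * inner ℂ z w / (1 - ‖z‖ ^ 2) ^ 2 : ℂ).re := by
  have h1 : ((1 : ℂ) - (‖z‖ : ℂ) ^ 2) = ((1 - ‖z‖ ^ 2 : ℝ) : ℂ) := by push_cast; ring
  have h2 : ((1 : ℂ) - (‖z‖ : ℂ) ^ 2) ^ 2 = (((1 - ‖z‖ ^ 2) ^ 2 : ℝ) : ℂ) := by push_cast; ring
  have h3 : (inner ℂ u z).re = (inner ℂ z u).re := inner_re_symm (𝕜 := ℂ) u z
  have h4 : (inner ℂ u z).im = -(inner ℂ z u).im := inner_im_symm (𝕜 := ℂ) u z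
  rw [h2, h1, Complex.add_re, Complex.div_ofReal_re, Complex.div_ofReal_re, Complex.mul_re, h3, h4]
  simp [chMetric, euclideanMetric, reInner, imInner]
  ring

/-! ### The metric `μ` -/

/-- Coordinates `(z, θ, r)` of the total space `E × (0, ∞)`, `E = ℂℍᵐ × 𝕊¹`: `‖z‖ < 1`, `θ` is the
angle on `𝕊¹ = ℝ / 2πℤ` (nothing below depends on `θ`, so one may work with `θ ∈ ℝ`), and `r > 0`.
A horizontal distribution which is invariant under `θ` and `r` and tangent to the `r`-tubes is given
by a 1-form `α` on `ℂℍᵐ`. -/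
abbrev Total (m : ℕ) : Type := Cn m × ℝ × ℝ

/-- The vertical coframe `dθ + α`: it is `1` on `∂/∂θ`, it is `0` on `∂/∂r` and its kernel consists
of the horizontal vectors and the multiples of `∂/∂r`. -/
def vertForm {m : ℕ} (α : Cn m → Cn m →L[ℝ] ℝ) (q : Total m) : Total m →L[ℝ] ℝ :=
  ContinuousLinearMap.fst ℝ ℝ ℝ ∘L ContinuousLinearMap.snd ℝ (Cn m) (ℝ × ℝ)
    + α q.1 ∘L ContinuousLinearMap.fst ℝ (Cn m) (ℝ × ℝ)

/-- The coframe `dr`. -/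
def radForm (m : ℕ) : Total m →L[ℝ] ℝ :=
  ContinuousLinearMap.snd ℝ ℝ ℝ ∘L ContinuousLinearMap.snd ℝ (Cn m) (ℝ × ℝ)

/-- The metric `μ = h² 𝔠_m + (1/4) v² dθ² + dr²`, where `dθ` stands for the vertical coframe which
vanishes on the horizontal distribution. -/
def mu {m : ℕ} (h v : ℝ → ℝ) (α : Cn m → Cn m →L[ℝ] ℝ) (q : Total m) :
    Total m →L[ℝ] Total m →L[ℝ] ℝ :=
  (h q.2.2 ^ 2) •
      (chMetric q.1).bilinearComp (ContinuousLinearMap.fst ℝ (Cn m) (ℝ × ℝ))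
        (ContinuousLinearMap.fst ℝ (Cn m) (ℝ × ℝ))
    + (1 / 4 * v q.2.2 ^ 2) • (vertForm α q).smulRight (vertForm α q)
    + (radForm m).smulRight (radForm m)

theorem mu_apply {m : ℕ} (h v : ℝ → ℝ) (α : Cn m → Cn m →L[ℝ] ℝ) (z u w : Cn m)
    (θ r a b s t : ℝ) :
    mu h v α (z, θ, r) (u, a, s) (w, b, t) =
      h r ^ 2 * chMetric z u w + 1 / 4 * v r ^ 2 * ((a + α z u) * (b + α z w)) + s * t := by
  simp [mu, vertForm, radForm]
  ring

/-- The coordinate vector `∂/∂θ`. -/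
def dTheta (m : ℕ) : Total m := (0, 1, 0)

/-! ### Holomorphic frames and structure constants -/

/-- The horizontal lift of a vector field `X` on `ℂℍᵐ`: it projects to `X`, it is invariant under
`θ` and `r`, and it is orthogonal to `∂/∂θ` and `∂/∂r` with respect to `μ`. -/
def horLift {m : ℕ} (α : Cn m → Cn m →L[ℝ] ℝ) (X : Cn m → Cn m) (q : Total m) : Total m :=
  (X q.1, -(α q.1 (X q.1)), 0)

/-- A holomorphic frame near `p ∈ ℂℍᵐ`: a smooth local orthonormal frame made of the `m` holomorphic
pairs `X (k, 0)`, `X (k, 1) = J X (k, 0)`, all of whose Lie brackets vanish at `p`. -/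
structure IsHolomorphicFrame {m : ℕ} (p : Cn m) (X : Fin m × Fin 2 → Cn m → Cn m) : Prop where
  smooth : ∀ i, ContDiffAt ℝ ∞ (X i) p
  orthonormal : ∀ᶠ z in 𝓝 p, ∀ i j, chMetric z (X i z) (X j z) = if i = j then 1 else 0
  holomorphic_pair : ∀ᶠ z in 𝓝 p, ∀ k, X (k, 1) z = Complex.I • X (k, 0) z
  bracket : ∀ i j, VectorField.lieBracket ℝ (X i) (X j) p = 0

/-- The horizontal distribution given by `α` has structure constants `c` at `q`, with respect to the
frame `X`.  At `q`, the brackets of the lifted frame are `[X (k, 0), X (k, 1)] = c k • ∂/∂θ`, and the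
brackets of fields from different pairs vanish.  Moreover the structure functions, i.e. the
`∂/∂θ`-components of the brackets, are constant to first order at `q` (in particular this holds
when they are constant near `q`). -/
structure HasStructureConstants {m : ℕ} (α : Cn m → Cn m →L[ℝ] ℝ) (q : Total m)
    (X : Fin m × Fin 2 → Cn m → Cn m) (c : Fin m → ℝ) : Prop where
  pair : ∀ k, VectorField.lieBracket ℝ (horLift α (X (k, 0))) (horLift α (X (k, 1))) q
    = c k • dTheta m
  nonpair : ∀ i j, i.1 ≠ j.1 →
    VectorField.lieBracket ℝ (horLift α (X i)) (horLift α (X j)) q = 0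
  constant : ∀ i j, HasFDerivAt
    (fun y ↦ vertForm α y (VectorField.lieBracket ℝ (horLift α (X i)) (horLift α (X j)) y))
    (0 : Total m →L[ℝ] ℝ) q

end PinchedCurvature

end

noncomputable section

namespace PinchedCurvature

/-! ### Curvature in terms of Christoffel symbols of the first kind -/

section General

variable {V : Type*} [NormedAddCommGroup V] [NormedSpace ℝ V]

/-! Write `u = (x, a, s)` and `w = (y, b, t)`, with `x, y` the components in complex hyperbolic
space, `a, b` the values of `dθ + α`, and `s, t` those of `dr`.

The structure constants enter in two ways. A holomorphic frame is parallel at `p`, so structure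
functions constant to first order mean `∇dα = 0` there, and no derivative of `dα` survives in the
curvature (`HasStructureConstants.fderiv_extD`). In the frame, the skew operator `j` representing
`dα` consists of 2×2 rotation blocks scaled by `±c k`, so `|j| ≤ max |c k|`
(`HasStructureConstants.exists_skew`). Then `mu_riemann` gives `g(R(u,w)w, u)` explicitly.

With `C = cosh r`, `S = sinh r`, put `W = C⁴|x∧y|²`, `F = C² dα(x,y)`, `p = C⁴S²|ay - bx|²`, `q =
C⁴S²|j(ay - bx)|²`, `z = C²|sy - tx|²`, `B = CS(sb - ta)`. The Gram determinant is `W + p + z + B²`.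
Apart from terms of relative size `1/C²`, the curvature numerator is `-N` with `N = W + ¾F² + 2p -
q/4 + 3FB + z + 4B²`.

If `|j| ≤ 2`, then `F² ≤ 4W` and `q ≤ 4p`, while Cauchy–Schwarz gives `(FB)² ≤ qz`. So `N - (W + p +
z + B²) = 3(B + F/2)² + (p - q/4) ≥ 0`, and `FB ≤ q/4 + z` gives `N ≤ 4(W + p + z + B²)`: the
curvature lies in `[-4, -1]`. `pinching_aux` carries this out with the errors from finite `r` and
`|c k| < 2 + η`, uniformly in `α` and the plane. -/

theorem christoffelLower_apply (g : V → V →L[ℝ] V →L[ℝ] ℝ) (x u v w : V) :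
    christoffelLower g x u v w =
      1 / 2 * (fderiv ℝ g x u v w + fderiv ℝ g x v u w - fderiv ℝ g x w u v) := by
  simp [christoffelLower]

theorem fderiv_symm {g : V → V →L[ℝ] V →L[ℝ] ℝ} (hs : ∀ y u v, g y u v = g y v u) {x : V}
    (hd : DifferentiableAt ℝ g x) (u v w : V) : fderiv ℝ g x w u v = fderiv ℝ g x w v u := by
  have h : ∀ u v, HasFDerivAt (fun y ↦ g y u v)
      (((fderiv ℝ g x).flip u).flip v) x := by
    intro u v
    have := (hd.hasFDerivAt.clm_apply (hasFDerivAt_const u x)).clm_apply (hasFDerivAt_const v x)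
    refine this.congr_fderiv ?_
    ext w
    simp
  have h1 := (h u v).unique ((h v u).congr_of_eventuallyEq (.of_forall fun y ↦ hs y u v))
  simpa using DFunLike.congr_fun h1 w

theorem christoffelLower_comm {g : V → V →L[ℝ] V →L[ℝ] ℝ} (hs : ∀ y u v, g y u v = g y v u) {x : V}
    (hd : DifferentiableAt ℝ g x) (u v : V) : christoffelLower g x u v = christoffelLower g x v u := by
  ext w
  rw [christoffelLower_apply, christoffelLower_apply, fderiv_symm hs hd u v w]
  ring

/-- The Levi-Civita connection is compatible with the metric. -/
theorem fderiv_eq_christoffelLower {g : V → V →L[ℝ] V →L[ℝ] ℝ} (hs : ∀ y u v, g y u v = g y v u)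
    {x : V} (hd : DifferentiableAt ℝ g x) (u v w : V) :
    fderiv ℝ g x u v w = christoffelLower g x u v w + christoffelLower g x u w v := by
  simp only [christoffelLower_apply]
  rw [fderiv_symm hs hd u v w, fderiv_symm hs hd w v u, fderiv_symm hs hd u w v]
  ring

theorem apply_christoffel {g : V → V →L[ℝ] V →L[ℝ] ℝ} {x : V} (hi : (g x).IsInvertible) (u v : V) :
    g x (christoffel g x u v) = christoffelLower g x u v :=
  hi.self_apply_inverse _

/-- By nondegeneracy, a proposed Christoffel vector need only be tested against the Koszul covector;
the metric is never inverted explicitly. -/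
theorem christoffel_eq {g : V → V →L[ℝ] V →L[ℝ] ℝ} {x : V} (hi : (g x).IsInvertible) {u v a : V}
    (h : ∀ w, christoffelLower g x u v w = g x a w) : christoffel g x u v = a := by
  have : christoffelLower g x u v = g x a := by ext w; exact h w
  rw [christoffel, this, hi.inverse_apply_self]

theorem isInvertible_of_pos [FiniteDimensional ℝ V] {B : V →L[ℝ] V →L[ℝ] ℝ}
    (h : ∀ u, u ≠ 0 → 0 < B u u) : B.IsInvertible := by
  have hinj : Function.Injective (B : V →ₗ[ℝ] V →L[ℝ] ℝ) := by
    rw [← LinearMap.ker_eq_bot, LinearMap.ker_eq_bot']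
    intro u hu
    by_contra hne
    have h1 := h u hne
    have h2 : B u = 0 := hu
    simp [h2] at h1
  have hdim : Module.finrank ℝ V = Module.finrank ℝ (V →L[ℝ] ℝ) := by
    rw [← (LinearMap.toContinuousLinearMap (𝕜 := ℝ) (E := V) (F' := ℝ)).finrank_eq]
    exact (Subspace.dual_finrank_eq (K := ℝ) (V := V)).symm
  refine ⟨(LinearEquiv.ofInjectiveOfFinrankEq (B : V →ₗ[ℝ] V →L[ℝ] ℝ) hinj
    hdim).toContinuousLinearEquiv, ?_⟩
  ext u w
  rfl

theorem differentiableAt_christoffelLower {g : V → V →L[ℝ] V →L[ℝ] ℝ} {x : V}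
    (hg : ContDiffAt ℝ 2 g x) (u v : V) :
    DifferentiableAt ℝ (fun y ↦ christoffelLower g y u v) x := by
  have hd := (hg.fderiv_right (m := 1) (by norm_num)).differentiableAt
    one_ne_zero
  have h1 : ∀ y, ((fderiv ℝ g y).flip u).flip v =
      (ContinuousLinearMap.apply ℝ ℝ v ∘L ContinuousLinearMap.apply ℝ (V →L[ℝ] ℝ) u) ∘L
        fderiv ℝ g y := fun y ↦ by
    ext w
    rfl
  simp only [christoffelLower, h1]
  exact ((((hd.clm_apply (differentiableAt_const u)).clm_apply (differentiableAt_const v)).add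
    ((hd.clm_apply (differentiableAt_const v)).clm_apply (differentiableAt_const u))).sub
    ((differentiableAt_const _).clm_comp hd)).const_smul (1 / 2 : ℝ)

theorem differentiableAt_christoffel [FiniteDimensional ℝ V] {g : V → V →L[ℝ] V →L[ℝ] ℝ} {x : V}
    (hg : ContDiffAt ℝ 2 g x) (hi : (g x).IsInvertible) (u v : V) :
    DifferentiableAt ℝ (fun y ↦ christoffel g y u v) x := by
  have : CompleteSpace V := FiniteDimensional.complete ℝ V
  have h1 : DifferentiableAt ℝ (fun y ↦ (g y).inverse) x :=
    ((hi.contDiffAt_map_inverse (n := 1)).differentiableAt one_ne_zero).comp x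
      (hg.differentiableAt two_ne_zero)
  exact h1.clm_apply (differentiableAt_christoffelLower hg u v)

/-- Differentiate `g(Γ(v, w), z) = christoffelLower g · v w z` along `u`. The derivative of `g` is
rewritten by metric compatibility, so only derivatives of the lower symbols along straight lines are
ever needed. -/
theorem apply_fderiv_christoffel [FiniteDimensional ℝ V] {g : V → V →L[ℝ] V →L[ℝ] ℝ} {x : V}
    (hs : ∀ y u v, g y u v = g y v u)
    (hg : ContDiffAt ℝ 2 g x) (hi : ∀ᶠ y in 𝓝 x, (g y).IsInvertible) {u v w z : V} {d : ℝ}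
    (h : HasDerivAt (fun s : ℝ ↦ christoffelLower g (x + s • u) v w z) d 0) :
    g x (fderiv ℝ (fun y ↦ christoffel g y v w) x u) z =
      d - g x (christoffel g x u (christoffel g x v w)) z
        - g x (christoffel g x u z) (christoffel g x v w) := by
  have hd := hg.differentiableAt two_ne_zero
  have hix := hi.self_of_nhds
  have hc := (differentiableAt_christoffel hg hix v w).hasFDerivAt
  have h1 := (hd.hasFDerivAt.clm_apply hc).clm_apply (hasFDerivAt_const z x)
  have h2 := h1.congr_of_eventuallyEq (f₁ := fun y ↦ christoffelLower g y v w z)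
    (by filter_upwards [hi] with y hy; rw [apply_christoffel hy])
  have hline : HasDerivAt (fun s : ℝ ↦ x + s • u) u 0 := by
    simpa using ((hasDerivAt_id (0 : ℝ)).smul_const u).const_add x
  have h2' : HasFDerivAt (F := ℝ) (fun y ↦ christoffelLower g y v w z) _ x := h2
  have h3 := h.unique (h2'.comp_hasDerivAt_of_eq (0 : ℝ) hline (by simp))
  simp at h3
  rw [fderiv_eq_christoffelLower hs hd, ← apply_christoffel hix, ← apply_christoffel hix] at h3
  linarith

/-- The curvature tensor in terms of Christoffel symbols of the first kind. -/
theorem apply_riemann [FiniteDimensional ℝ V] {g : V → V →L[ℝ] V →L[ℝ] ℝ} {x : V}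
    (hs : ∀ y u v, g y u v = g y v u)
    (hg : ContDiffAt ℝ 2 g x) (hi : ∀ᶠ y in 𝓝 x, (g y).IsInvertible) {u v : V} {d₁ d₂ : ℝ}
    (h₁ : HasDerivAt (fun s : ℝ ↦ christoffelLower g (x + s • u) v v u) d₁ 0)
    (h₂ : HasDerivAt (fun s : ℝ ↦ christoffelLower g (x + s • v) u v u) d₂ 0) :
    g x (riemann g x u v v) u = d₁ - d₂ + g x (christoffel g x u v) (christoffel g x u v)
      - g x (christoffel g x u u) (christoffel g x v v) := by
  have e₁ := apply_fderiv_christoffel hs hg hi h₁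
  have e₂ := apply_fderiv_christoffel hs hg hi h₂
  have hd := hg.differentiableAt two_ne_zero
  have hc : christoffel g x v u = christoffel g x u v := by
    simp only [christoffel, christoffelLower_comm hs hd u v]
  simp only [riemann, map_add, map_sub, add_apply,
    sub_apply, e₁, e₂, hc]
  ring

end General

/-! ### Complex hyperbolic space: connection and curvature -/

section ComplexHyperbolic

variable {m : ℕ}

/-- The Hermitian form whose real part is `chMetric`. -/
def chHerm (z u w : Cn m) : ℂ :=
  inner ℂ u w / (1 - inner ℂ z z) + inner ℂ u z * inner ℂ z w / (1 - inner ℂ z z) ^ 2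

theorem chMetric_eq_re (z u w : Cn m) : chMetric z u w = (chHerm z u w).re := by
  rw [chMetric_apply, chHerm, inner_self_eq_norm_sq_to_K]
  rfl

theorem one_sub_inner_self_ne_zero {z : Cn m} (hz : ‖z‖ < 1) : (1 - inner ℂ z z : ℂ) ≠ 0 := by
  rw [inner_self_eq_norm_sq_to_K]
  have h : (1 - ‖z‖ ^ 2 : ℝ) ≠ 0 := by nlinarith [norm_nonneg z]
  have h' : ((1 - ‖z‖ ^ 2 : ℝ) : ℂ) ≠ 0 := Complex.ofReal_ne_zero.mpr h
  simpa using h'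

theorem chHerm_conj (z u w : Cn m) : (starRingEnd ℂ) (chHerm z u w) = chHerm z w u := by
  simp only [chHerm, map_add, map_div₀, map_mul, map_sub, map_one, map_pow, inner_conj_symm]
  ring

theorem chHerm_smul_left (z u w : Cn m) (a : ℂ) :
    chHerm z (a • u) w = (starRingEnd ℂ) a * chHerm z u w := by
  simp only [chHerm, inner_smul_left]; ring

theorem chHerm_smul_right (z u w : Cn m) (a : ℂ) :
    chHerm z w (a • u) = a * chHerm z w u := by
  simp only [chHerm, inner_smul_right]; ring

theorem chMetric_comm (z u w : Cn m) : chMetric z u w = chMetric z w u := by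
  rw [chMetric_eq_re, chMetric_eq_re, ← chHerm_conj z u w, Complex.conj_re]

theorem chMetric_I_smul (z u w : Cn m) : chMetric z (Complex.I • u) w = (chHerm z u w).im := by
  rw [chMetric_eq_re, chHerm_smul_left]; simp

theorem chMetric_I_smul_smul (z u w : Cn m) :
    chMetric z (Complex.I • u) (Complex.I • w) = chMetric z u w := by
  rw [chMetric_I_smul, chHerm_smul_right, chMetric_eq_re]; simp

theorem chMetric_self_pos {z : Cn m} (hz : ‖z‖ < 1) {u : Cn m} (hu : u ≠ 0) :
    0 < chMetric z u u := by
  have h1 : 0 < 1 - ‖z‖ ^ 2 := by nlinarith [norm_nonneg z]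
  have h2 : 0 < ‖u‖ ^ 2 := by positivity
  have h3 : (inner ℂ u u : ℂ).re = ‖u‖ ^ 2 := by
    rw [inner_self_eq_norm_sq_to_K]; norm_cast
  have h4 : chMetric z u u = (1 / (1 - ‖z‖ ^ 2)) * ‖u‖ ^ 2 + (1 / (1 - ‖z‖ ^ 2) ^ 2) *
      ((inner ℂ z u : ℂ).re ^ 2 + (inner ℂ z u : ℂ).im ^ 2) := by
    rw [← h3]
    simp [chMetric, euclideanMetric, reInner, imInner, -inner_self_eq_norm_sq_to_K]
    ring
  rw [h4]
  positivity

theorem chMetric_self_nonneg {z : Cn m} (hz : ‖z‖ < 1) (u : Cn m) : 0 ≤ chMetric z u u := by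
  rcases eq_or_ne u 0 with rfl | hu
  · simp
  · exact (chMetric_self_pos hz hu).le

/-- The Christoffel symbols of `chMetric`. -/
def chGamma (z u v : Cn m) : Cn m :=
  (1 - inner ℂ z z : ℂ)⁻¹ • ((inner ℂ z u : ℂ) • v + (inner ℂ z v : ℂ) • u)

theorem chGamma_comm (z u v : Cn m) : chGamma z u v = chGamma z v u := by
  rw [chGamma, chGamma, add_comm]

theorem hasDerivAt_line {E : Type*} [NormedAddCommGroup E] [NormedSpace ℝ E] (z x : E) :
    HasDerivAt (fun s : ℝ ↦ z + s • x) x 0 := by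
  simpa using ((hasDerivAt_id (0 : ℝ)).smul_const x).const_add z

theorem hasDerivAt_comp_line {E F : Type*} [NormedAddCommGroup E] [NormedSpace ℝ E]
    [NormedAddCommGroup F] [NormedSpace ℝ F] {f : E → F} {z : E} (hf : DifferentiableAt ℝ f z)
    (x : E) : HasDerivAt (fun s : ℝ ↦ f (z + s • x)) (fderiv ℝ f z x) 0 :=
  hf.hasFDerivAt.comp_hasDerivAt_of_eq (0 : ℝ) (hasDerivAt_line z x) (by simp)

/-- Compatibility holds for the whole Hermitian form, not only for its real part, because `chGamma`
is complex bilinear. With `chGamma_comm` this identifies `chGamma` as the Levi-Civita connection. -/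
theorem hasDerivAt_chHerm {z : Cn m} (hz : ‖z‖ < 1) (x u w : Cn m) :
    HasDerivAt (fun s : ℝ ↦ chHerm (z + s • x) u w)
      (chHerm z (chGamma z x u) w + chHerm z u (chGamma z x w)) 0 := by
  have hl := hasDerivAt_line z x
  have hρ := one_sub_inner_self_ne_zero hz
  have h1 := (hl.inner ℂ hl).const_sub (1 : ℂ)
  have h2 := (hasDerivAt_const (0 : ℝ) u).inner ℂ hl
  have h3 := hl.inner ℂ (hasDerivAt_const (0 : ℝ) w)
  have h4 := ((hasDerivAt_const (0 : ℝ) (inner ℂ u w : ℂ)).div h1 (by simpa using hρ)).add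
    ((h2.mul h3).div (h1.pow 2) (by simpa using hρ))
  refine h4.congr_deriv ?_
  simp only [chHerm, chGamma, inner_smul_left, inner_smul_right, inner_add_left, inner_add_right,
    zero_smul, add_zero, inner_zero_left, inner_zero_right, map_inv₀, map_sub, map_one,
    inner_conj_symm, zero_add, zero_mul, Pi.pow_apply, Pi.mul_apply]
  field_simp
  ring

theorem contDiffOn_chMetric : ContDiffOn ℝ ∞ (chMetric (m := m)) (Metric.ball 0 1) := by
  rw [contDiffOn_clm_apply]
  intro u
  rw [contDiffOn_clm_apply]
  intro w
  simp only [chMetric_eq_re, chHerm, div_eq_mul_inv]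
  have hne : ∀ z ∈ Metric.ball (0 : Cn m) 1, (1 - inner ℂ z z : ℂ) ≠ 0 := fun z hz ↦
    one_sub_inner_self_ne_zero (by simpa using hz)
  have h1 : ContDiff ℝ ∞ (fun z : Cn m ↦ (1 - inner ℂ z z : ℂ)) :=
    contDiff_const.sub (contDiff_id.inner ℂ contDiff_id)
  have h2 : ContDiff ℝ ∞ (fun z : Cn m ↦ (inner ℂ u z * inner ℂ z w : ℂ)) :=
    (contDiff_const.inner ℂ contDiff_id).mul (contDiff_id.inner ℂ contDiff_const)
  exact Complex.reCLM.contDiff.comp_contDiffOn ((contDiffOn_const.mul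
    (h1.contDiffOn.inv hne)).add
    (h2.contDiffOn.mul ((h1.pow 2).contDiffOn.inv fun z hz ↦ pow_ne_zero 2 (hne z hz))))

theorem ball_mem_nhds {z : Cn m} (hz : ‖z‖ < 1) : Metric.ball (0 : Cn m) 1 ∈ 𝓝 z :=
  Metric.isOpen_ball.mem_nhds (by simpa using hz)

theorem differentiableAt_chMetric {z : Cn m} (hz : ‖z‖ < 1) :
    DifferentiableAt ℝ (chMetric (m := m)) z :=
  (contDiffOn_chMetric.contDiffAt (ball_mem_nhds hz)).differentiableAt (by simp)

theorem fderiv_chMetric {z : Cn m} (hz : ‖z‖ < 1) (x u w : Cn m) :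
    fderiv ℝ chMetric z x u w = chMetric z (chGamma z x u) w + chMetric z u (chGamma z x w) := by
  have h1 := ((differentiableAt_chMetric hz).hasFDerivAt.clm_apply
    (hasFDerivAt_const u z)).clm_apply (hasFDerivAt_const w z)
  have h2 := h1.comp_hasDerivAt_of_eq (0 : ℝ) (hasDerivAt_line z x) (by simp)
  have h3 := Complex.reCLM.hasFDerivAt.comp_hasDerivAt (0 : ℝ) (hasDerivAt_chHerm hz x u w)
  have h4 := h2.unique (h3.congr_of_eventuallyEq (.of_forall fun s ↦ by
    simp [chMetric_eq_re]))
  simpa [chMetric_eq_re] using h4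

theorem hasDerivAt_chMetric {z : Cn m} (hz : ‖z‖ < 1) (x : Cn m) {U W : ℝ → Cn m} {u' w' : Cn m}
    (hU : HasDerivAt U u' 0) (hW : HasDerivAt W w' 0) :
    HasDerivAt (fun s : ℝ ↦ chMetric (z + s • x) (U s) (W s))
      (chMetric z (chGamma z x (U 0) + u') (W 0) + chMetric z (U 0) (chGamma z x (W 0) + w'))
      0 := by
  have h0 : HasDerivAt (fun s : ℝ ↦ chMetric (z + s • x)) (fderiv ℝ chMetric z x) 0 :=
    hasDerivAt_comp_line (F := Cn m →L[ℝ] Cn m →L[ℝ] ℝ) (differentiableAt_chMetric hz) x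
  refine ((h0.clm_apply hU).clm_apply hW).congr_deriv ?_
  simp [fderiv_chMetric hz]
  ring

/-- The derivative of `chGamma z u v` in the direction `x`. -/
def chGammaDeriv (z x u v : Cn m) : Cn m :=
  (1 - inner ℂ z z : ℂ)⁻¹ • ((inner ℂ x u : ℂ) • v + (inner ℂ x v : ℂ) • u) +
    ((inner ℂ z x + inner ℂ x z : ℂ) * ((1 - inner ℂ z z : ℂ)⁻¹) ^ 2) •
      ((inner ℂ z u : ℂ) • v + (inner ℂ z v : ℂ) • u)

theorem hasDerivAt_chGamma {z : Cn m} (hz : ‖z‖ < 1) (x u v : Cn m) :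
    HasDerivAt (fun s : ℝ ↦ chGamma (z + s • x) u v) (chGammaDeriv z x u v) 0 := by
  have hl := hasDerivAt_line z x
  have hρ := one_sub_inner_self_ne_zero hz
  have h1 := (hl.inner ℂ hl).const_sub (1 : ℂ)
  have h2 := hl.inner ℂ (hasDerivAt_const (0 : ℝ) u)
  have h3 := hl.inner ℂ (hasDerivAt_const (0 : ℝ) v)
  refine ((h1.inv (by simpa using hρ)).smul
    ((h2.smul_const v).add (h3.smul_const u))).congr_deriv ?_
  simp only [chGammaDeriv, zero_smul, add_zero, inner_zero_right, zero_add, Pi.add_apply, Pi.inv_apply]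
  match_scalars <;> field_simp

/-- This is `R(x, y)y = (2H(x, y) - H(y, x)) y - H(y, y) x` for the Hermitian form `H`, an identity
between the coefficients of `x` and `y`. -/
theorem chGamma_curvature {z : Cn m} (hz : ‖z‖ < 1) (x y : Cn m) :
    chGammaDeriv z x y y + chGamma z x (chGamma z y y) =
      chGammaDeriv z y x y + chGamma z y (chGamma z x y) +
        (2 * chHerm z x y - chHerm z y x) • y - chHerm z y y • x := by
  have hρ := one_sub_inner_self_ne_zero hz
  simp only [chGammaDeriv, chGamma, chHerm, inner_add_right, inner_smul_right]
  match_scalars <;> field_simp <;> ring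

/-- Complex hyperbolic space has constant holomorphic sectional curvature `-4`. -/
theorem chMetric_curvature {z : Cn m} (hz : ‖z‖ < 1) (x y : Cn m) :
    chMetric z (chGammaDeriv z x y y + chGamma z x (chGamma z y y)) x -
      chMetric z (chGammaDeriv z y x y + chGamma z y (chGamma z x y)) x =
    -(chMetric z x x * chMetric z y y - chMetric z x y ^ 2
      + 3 * chMetric z (Complex.I • x) y ^ 2) := by
  rw [chGamma_curvature hz x y, chMetric_I_smul]
  simp only [sub_eq_add_neg, map_add, add_apply, ← neg_smul]
  simp only [chMetric_eq_re, chHerm_smul_left, map_add, map_neg, map_mul, chHerm_conj]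
  have h1 : chHerm z y x = (starRingEnd ℂ) (chHerm z x y) := (chHerm_conj _ _ _).symm
  have h2 : (chHerm z y y).im = 0 := by
    have := congrArg Complex.im (chHerm_conj z y y)
    simp at this
    linarith
  rw [h1]
  simp [h2]
  ring

end ComplexHyperbolic

/-! ### The connection of the metric `μ` -/

section TotalMetric

variable {m : ℕ}

theorem vertForm_apply (α : Cn m → Cn m →L[ℝ] ℝ) (q u : Total m) :
    vertForm α q u = u.2.1 + α q.1 u.1 := rfl

theorem mu_apply' (h v : ℝ → ℝ) (α : Cn m → Cn m →L[ℝ] ℝ) (q u w : Total m) :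
    mu h v α q u w = h q.2.2 ^ 2 * chMetric q.1 u.1 w.1
      + 1 / 4 * v q.2.2 ^ 2 * (vertForm α q u * vertForm α q w) + u.2.2 * w.2.2 :=
  mu_apply h v α q.1 u.1 w.1 q.2.1 q.2.2 u.2.1 w.2.1 u.2.2 w.2.2

theorem mu_comm (h v : ℝ → ℝ) (α : Cn m → Cn m →L[ℝ] ℝ) (q u w : Total m) :
    mu h v α q u w = mu h v α q w u := by
  rw [mu_apply', mu_apply', chMetric_comm]
  ring

theorem mu_self_pos {h v : ℝ → ℝ} (α : Cn m → Cn m →L[ℝ] ℝ) {q u : Total m} (hq : ‖q.1‖ < 1)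
    (hh : h q.2.2 ≠ 0) (hv : v q.2.2 ≠ 0) (hu : u ≠ 0) : 0 < mu h v α q u u := by
  rw [mu_apply']
  have h0 := chMetric_self_nonneg hq u.1
  by_contra hcon
  have e1 : 0 ≤ h q.2.2 ^ 2 * chMetric q.1 u.1 u.1 := by positivity
  have e2 : 0 ≤ 1 / 4 * v q.2.2 ^ 2 * (vertForm α q u * vertForm α q u) :=
    mul_nonneg (by positivity) (mul_self_nonneg _)
  have e3 := mul_self_nonneg u.2.2
  have f1 : h q.2.2 ^ 2 * chMetric q.1 u.1 u.1 = 0 := by linarith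
  have f2 : 1 / 4 * v q.2.2 ^ 2 * (vertForm α q u * vertForm α q u) = 0 := by linarith
  have f3 : u.2.2 * u.2.2 = 0 := by linarith
  have g1 : u.1 = 0 := by
    by_contra hne
    have := mul_pos (pow_pos (abs_pos.mpr hh) 2) (chMetric_self_pos hq hne)
    rw [sq_abs] at this
    linarith
  have g3 : u.2.2 = 0 := by simpa using f3
  have g2 : vertForm α q u = 0 := by simpa [hv] using f2
  rw [vertForm_apply, g1, map_zero, add_zero] at g2
  exact hu (Prod.ext g1 (Prod.ext g2 g3))

theorem contDiffOn_mu {h v : ℝ → ℝ} (hh : ContDiff ℝ ∞ h) (hv : ContDiff ℝ ∞ v)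
    {α : Cn m → Cn m →L[ℝ] ℝ} (hα : ContDiffOn ℝ ∞ α (Metric.ball 0 1)) :
    ContDiffOn ℝ ∞ (mu h v α) {q : Total m | q.1 ∈ Metric.ball 0 1} := by
  rw [contDiffOn_clm_apply]
  intro u
  rw [contDiffOn_clm_apply]
  intro w
  simp only [mu_apply', vertForm_apply]
  have hr : ContDiff ℝ ∞ (fun q : Total m ↦ q.2.2) := by fun_prop
  have hz : ContDiff ℝ ∞ (fun q : Total m ↦ q.1) := by fun_prop
  have h1 : ContDiffOn ℝ ∞ (fun q : Total m ↦ chMetric q.1) {q : Total m | q.1 ∈ Metric.ball 0 1} :=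
    contDiffOn_chMetric.comp hz.contDiffOn fun q hq ↦ hq
  have h2 : ContDiffOn ℝ ∞ (fun q : Total m ↦ α q.1) {q : Total m | q.1 ∈ Metric.ball 0 1} :=
    hα.comp hz.contDiffOn fun q hq ↦ hq
  exact (((((hh.comp hr).pow 2).contDiffOn.mul ((h1.clm_apply contDiffOn_const).clm_apply
    contDiffOn_const)).add
    ((contDiffOn_const.mul ((hv.comp hr).pow 2).contDiffOn).mul
      ((contDiffOn_const.add (h2.clm_apply contDiffOn_const)).mul
        (contDiffOn_const.add (h2.clm_apply contDiffOn_const))))).add contDiffOn_const)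

theorem tube_mem_nhds {q : Total m} (hq : ‖q.1‖ < 1) :
    {q : Total m | q.1 ∈ Metric.ball (0 : Cn m) 1} ∈ 𝓝 q :=
  (Metric.isOpen_ball.preimage continuous_fst).mem_nhds (by simpa using hq)

section

variable {h v k₁ l₁ : ℝ → ℝ} {α : Cn m → Cn m →L[ℝ] ℝ}

theorem fderiv_mu (hh : ContDiff ℝ ∞ h) (hv : ContDiff ℝ ∞ v)
    (hα : ContDiffOn ℝ ∞ α (Metric.ball 0 1))
    (hk : ∀ r, HasDerivAt (fun r ↦ h r ^ 2) (k₁ r) r)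
    (hl : ∀ r, HasDerivAt (fun r ↦ 1 / 4 * v r ^ 2) (l₁ r) r)
    {q : Total m} (hq : ‖q.1‖ < 1) (w u u' : Total m) :
    fderiv ℝ (mu h v α) q w u u' =
      k₁ q.2.2 * w.2.2 * chMetric q.1 u.1 u'.1 +
      h q.2.2 ^ 2 * (chMetric q.1 (chGamma q.1 w.1 u.1) u'.1
        + chMetric q.1 u.1 (chGamma q.1 w.1 u'.1)) +
      l₁ q.2.2 * w.2.2 * (vertForm α q u * vertForm α q u') +
      1 / 4 * v q.2.2 ^ 2 * (fderiv ℝ α q.1 w.1 u.1 * vertForm α q u' +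
        vertForm α q u * fderiv ℝ α q.1 w.1 u'.1) := by
  have hd : DifferentiableAt ℝ (mu h v α) q :=
    ((contDiffOn_mu hh hv hα).contDiffAt (tube_mem_nhds hq)).differentiableAt (by simp)
  have hdα : DifferentiableAt ℝ α q.1 :=
    (hα.contDiffAt (ball_mem_nhds hq)).differentiableAt (by simp)
  have h1 := ((hasDerivAt_comp_line (F := Total m →L[ℝ] Total m →L[ℝ] ℝ) hd w).clm_apply
    (hasDerivAt_const (0 : ℝ) u)).clm_apply (hasDerivAt_const (0 : ℝ) u')
  have hr : HasDerivAt (fun s : ℝ ↦ q.2.2 + s * w.2.2) w.2.2 0 := by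
    simpa using ((hasDerivAt_id (0 : ℝ)).mul_const w.2.2).const_add q.2.2
  have h2 := (hk q.2.2).comp_of_eq (0 : ℝ) hr (by simp)
  have h3 := (hl q.2.2).comp_of_eq (0 : ℝ) hr (by simp)
  have h4 := hasDerivAt_chMetric hq w.1 (hasDerivAt_const (0 : ℝ) u.1)
    (hasDerivAt_const (0 : ℝ) u'.1)
  have h5 := hasDerivAt_comp_line (F := Cn m →L[ℝ] ℝ) hdα w.1
  have h6 := (h5.clm_apply (hasDerivAt_const (0 : ℝ) u.1)).const_add u.2.1
  have h7 := (h5.clm_apply (hasDerivAt_const (0 : ℝ) u'.1)).const_add u'.2.1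
  have h8 := ((h2.mul h4).add (h3.mul (h6.mul h7))).add_const (u.2.2 * u'.2.2)
  have h9 := h1.unique (h8.congr_of_eventuallyEq (.of_forall fun s ↦ by
    simp [mu_apply', vertForm_apply]))
  simp at h9
  rw [h9]
  simp [vertForm_apply]
  ring

/-- The exterior derivative of the 1-form `α`. -/
def extD (α : Cn m → Cn m →L[ℝ] ℝ) (z x y : Cn m) : ℝ :=
  fderiv ℝ α z x y - fderiv ℝ α z y x

theorem christoffelLower_mu (hh : ContDiff ℝ ∞ h) (hv : ContDiff ℝ ∞ v)
    (hα : ContDiffOn ℝ ∞ α (Metric.ball 0 1))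
    (hk : ∀ r, HasDerivAt (fun r ↦ h r ^ 2) (k₁ r) r)
    (hl : ∀ r, HasDerivAt (fun r ↦ 1 / 4 * v r ^ 2) (l₁ r) r)
    {q : Total m} (hq : ‖q.1‖ < 1) (u u' w : Total m) :
    christoffelLower (mu h v α) q u u' w =
      h q.2.2 ^ 2 * chMetric q.1 (chGamma q.1 u.1 u'.1) w.1 +
      k₁ q.2.2 * (1 / 2 * (u.2.2 * chMetric q.1 u'.1 w.1 + u'.2.2 * chMetric q.1 u.1 w.1
        - w.2.2 * chMetric q.1 u.1 u'.1)) +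
      l₁ q.2.2 * (1 / 2 * (u.2.2 * (vertForm α q u' * vertForm α q w)
        + u'.2.2 * (vertForm α q u * vertForm α q w)
        - w.2.2 * (vertForm α q u * vertForm α q u'))) +
      1 / 4 * v q.2.2 ^ 2 * (1 / 2 *
        ((fderiv ℝ α q.1 u.1 u'.1 + fderiv ℝ α q.1 u'.1 u.1) * vertForm α q w
          + vertForm α q u' * (fderiv ℝ α q.1 u.1 w.1 - fderiv ℝ α q.1 w.1 u.1)
          + vertForm α q u * (fderiv ℝ α q.1 u'.1 w.1 - fderiv ℝ α q.1 w.1 u'.1))) := by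
  rw [christoffelLower_apply]
  simp only [fderiv_mu hh hv hα hk hl hq]
  rw [chGamma_comm q.1 w.1 u.1, chGamma_comm q.1 w.1 u'.1, chGamma_comm q.1 u'.1 u.1,
    chMetric_comm q.1 u.1 (chGamma q.1 u'.1 w.1), chMetric_comm q.1 u'.1 (chGamma q.1 u.1 w.1)]
  ring

/-- Supplies the two line derivatives required by `apply_riemann`. Derivatives of `chMetric` are
written through `chGamma`, so that the combination `chGammaDeriv + chGamma ∘ chGamma` of
`chMetric_curvature` appears. -/
theorem hasDerivAt_christoffelLower_mu (hh : ContDiff ℝ ∞ h) (hv : ContDiff ℝ ∞ v)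
    (hα : ContDiffOn ℝ ∞ α (Metric.ball 0 1))
    (hk : ∀ r, HasDerivAt (fun r ↦ h r ^ 2) (k₁ r) r)
    (hl : ∀ r, HasDerivAt (fun r ↦ 1 / 4 * v r ^ 2) (l₁ r) r)
    {q : Total m} (hq : ‖q.1‖ < 1) {k₂ l₂ : ℝ}
    (hk₁ : HasDerivAt k₁ k₂ q.2.2) (hl₁ : HasDerivAt l₁ l₂ q.2.2) (d u u' w : Total m) :
    HasDerivAt (fun s : ℝ ↦ christoffelLower (mu h v α) (q + s • d) u u' w)
      (k₁ q.2.2 * d.2.2 * chMetric q.1 (chGamma q.1 u.1 u'.1) w.1 +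
        h q.2.2 ^ 2 *
          (chMetric q.1 (chGammaDeriv q.1 d.1 u.1 u'.1
              + chGamma q.1 d.1 (chGamma q.1 u.1 u'.1)) w.1
            + chMetric q.1 (chGamma q.1 u.1 u'.1) (chGamma q.1 d.1 w.1)) +
        (k₂ * d.2.2 * (1 / 2 * (u.2.2 * chMetric q.1 u'.1 w.1 + u'.2.2 * chMetric q.1 u.1 w.1
            - w.2.2 * chMetric q.1 u.1 u'.1)) +
          k₁ q.2.2 * (1 / 2 * (
            u.2.2 * (chMetric q.1 (chGamma q.1 d.1 u'.1) w.1
              + chMetric q.1 u'.1 (chGamma q.1 d.1 w.1))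
            + u'.2.2 * (chMetric q.1 (chGamma q.1 d.1 u.1) w.1
              + chMetric q.1 u.1 (chGamma q.1 d.1 w.1))
            - w.2.2 * (chMetric q.1 (chGamma q.1 d.1 u.1) u'.1
              + chMetric q.1 u.1 (chGamma q.1 d.1 u'.1))))) +
        (l₂ * d.2.2 * (1 / 2 * (u.2.2 * (vertForm α q u' * vertForm α q w)
            + u'.2.2 * (vertForm α q u * vertForm α q w)
            - w.2.2 * (vertForm α q u * vertForm α q u'))) +
          l₁ q.2.2 * (1 / 2 * (
            u.2.2 * (fderiv ℝ α q.1 d.1 u'.1 * vertForm α q w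
              + vertForm α q u' * fderiv ℝ α q.1 d.1 w.1)
            + u'.2.2 * (fderiv ℝ α q.1 d.1 u.1 * vertForm α q w
              + vertForm α q u * fderiv ℝ α q.1 d.1 w.1)
            - w.2.2 * (fderiv ℝ α q.1 d.1 u.1 * vertForm α q u'
              + vertForm α q u * fderiv ℝ α q.1 d.1 u'.1)))) +
        (l₁ q.2.2 * d.2.2 * (1 / 2 *
            ((fderiv ℝ α q.1 u.1 u'.1 + fderiv ℝ α q.1 u'.1 u.1) * vertForm α q w
              + vertForm α q u' * (fderiv ℝ α q.1 u.1 w.1 - fderiv ℝ α q.1 w.1 u.1)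
              + vertForm α q u * (fderiv ℝ α q.1 u'.1 w.1 - fderiv ℝ α q.1 w.1 u'.1))) +
          1 / 4 * v q.2.2 ^ 2 * (1 / 2 *
            ((fderiv ℝ (fderiv ℝ α) q.1 d.1 u.1 u'.1 + fderiv ℝ (fderiv ℝ α) q.1 d.1 u'.1 u.1)
                * vertForm α q w
              + (fderiv ℝ α q.1 u.1 u'.1 + fderiv ℝ α q.1 u'.1 u.1) * fderiv ℝ α q.1 d.1 w.1
              + fderiv ℝ α q.1 d.1 u'.1 * (fderiv ℝ α q.1 u.1 w.1 - fderiv ℝ α q.1 w.1 u.1)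
              + vertForm α q u' * (fderiv ℝ (fderiv ℝ α) q.1 d.1 u.1 w.1
                - fderiv ℝ (fderiv ℝ α) q.1 d.1 w.1 u.1)
              + fderiv ℝ α q.1 d.1 u.1 * (fderiv ℝ α q.1 u'.1 w.1 - fderiv ℝ α q.1 w.1 u'.1)
              + vertForm α q u * (fderiv ℝ (fderiv ℝ α) q.1 d.1 u'.1 w.1
                - fderiv ℝ (fderiv ℝ α) q.1 d.1 w.1 u'.1))))) 0 := by
  have hcα : ContDiffAt ℝ ∞ α q.1 := hα.contDiffAt (ball_mem_nhds hq)
  have hdα : DifferentiableAt ℝ α q.1 := hcα.differentiableAt (by simp)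
  have hddα : DifferentiableAt ℝ (fderiv ℝ α) q.1 :=
    (hcα.fderiv_right (m := 1) (by norm_cast)).differentiableAt one_ne_zero
  have hr : HasDerivAt (fun s : ℝ ↦ q.2.2 + s * d.2.2) d.2.2 0 := by
    simpa using ((hasDerivAt_id (0 : ℝ)).mul_const d.2.2).const_add q.2.2
  have ek := (hk q.2.2).comp_of_eq (0 : ℝ) hr (by simp)
  have el := (hl q.2.2).comp_of_eq (0 : ℝ) hr (by simp)
  have ek₁ := hk₁.comp_of_eq (0 : ℝ) hr (by simp)
  have el₁ := hl₁.comp_of_eq (0 : ℝ) hr (by simp)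
  have ec (a b : Cn m) := hasDerivAt_chMetric hq d.1 (hasDerivAt_const (0 : ℝ) a)
    (hasDerivAt_const (0 : ℝ) b)
  have eΓ := hasDerivAt_chMetric hq d.1 (hasDerivAt_chGamma hq d.1 u.1 u'.1)
    (hasDerivAt_const (0 : ℝ) w.1)
  have ev (a : Total m) := ((hasDerivAt_comp_line (F := Cn m →L[ℝ] ℝ) hdα d.1).clm_apply
    (hasDerivAt_const (0 : ℝ) a.1)).const_add a.2.1
  have eD (a b : Cn m) := ((hasDerivAt_comp_line (F := Cn m →L[ℝ] Cn m →L[ℝ] ℝ) hddα d.1).clm_apply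
    (hasDerivAt_const (0 : ℝ) a)).clm_apply (hasDerivAt_const (0 : ℝ) b)
  have main := (((ek.mul eΓ).add (ek₁.mul ((((ec u'.1 w.1).const_mul u.2.2).add
      ((ec u.1 w.1).const_mul u'.2.2)).sub ((ec u.1 u'.1).const_mul w.2.2) |>.const_mul (1 / 2)))).add
    (el₁.mul (((((ev u').mul (ev w)).const_mul u.2.2).add
      (((ev u).mul (ev w)).const_mul u'.2.2)).sub
        (((ev u).mul (ev u')).const_mul w.2.2) |>.const_mul (1 / 2)))).add
    (el.mul ((((((eD u.1 u'.1).add (eD u'.1 u.1)).mul (ev w)).add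
      ((ev u').mul ((eD u.1 w.1).sub (eD w.1 u.1)))).add
      ((ev u).mul ((eD u'.1 w.1).sub (eD w.1 u'.1)))).const_mul (1 / 2)))
  have hev : ∀ᶠ s : ℝ in 𝓝 0, ‖(q + s • d).1‖ < 1 := by
    have hc : Continuous (fun s : ℝ ↦ ‖(q + s • d).1‖) := by fun_prop
    exact hc.continuousAt.eventually_lt continuousAt_const (by simpa using hq)
  refine (main.congr_of_eventuallyEq ?_).congr_deriv ?_
  · filter_upwards [hev] with s hs
    rw [christoffelLower_mu hh hv hα hk hl hs]
    simp [vertForm_apply]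
  · simp [vertForm_apply]
    ring

end

end TotalMetric

/-! ### The curvature of the metric `μ` -/

section TotalCurvature

variable {m : ℕ} {h v k₁ l₁ : ℝ → ℝ} {α : Cn m → Cn m →L[ℝ] ℝ}

theorem two_le_infty : (2 : WithTop ℕ∞) ≤ ∞ := by
  have : ((2 : ℕ∞) : WithTop ℕ∞) ≤ ((⊤ : ℕ∞) : WithTop ℕ∞) := WithTop.coe_le_coe.2 le_top
  exact this

theorem vertForm_mk (α : Cn m → Cn m →L[ℝ] ℝ) (q : Total m) (x : Cn m) (a s : ℝ) :
    vertForm α q (x, a - α q.1 x, s) = a := by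
  simp [vertForm_apply]

theorem eventually_isInvertible_mu (hh : ContDiff ℝ ∞ h) (hv : ContDiff ℝ ∞ v) {q : Total m}
    (hq : ‖q.1‖ < 1) (hh₀ : h q.2.2 ≠ 0) (hv₀ : v q.2.2 ≠ 0) :
    ∀ᶠ y in 𝓝 q, (mu h v α y).IsInvertible := by
  have e1 : ∀ᶠ y : Total m in 𝓝 q, h y.2.2 ≠ 0 :=
    (hh.continuous.comp (by fun_prop : Continuous fun y : Total m ↦ y.2.2)).continuousAt.eventually_ne
      hh₀
  have e2 : ∀ᶠ y : Total m in 𝓝 q, v y.2.2 ≠ 0 :=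
    (hv.continuous.comp (by fun_prop : Continuous fun y : Total m ↦ y.2.2)).continuousAt.eventually_ne
      hv₀
  filter_upwards [e1, e2, tube_mem_nhds hq] with y h1 h2 h3
  exact isInvertible_of_pos fun u hu ↦ mu_self_pos α (by simpa using h3) h1 h2 hu

/-- Here `κ = h'/h`, `ν = v'/v` and `2ρ = v²/(4h²)`, encoded without division. Subtracting `α` of
the first component in the `θ`-slot makes the vertical form of the vector the expression in front of
it (`vertForm_mk`). -/
theorem christoffel_mu (hh : ContDiff ℝ ∞ h) (hv : ContDiff ℝ ∞ v)
    (hα : ContDiffOn ℝ ∞ α (Metric.ball 0 1))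
    (hk : ∀ r, HasDerivAt (fun r ↦ h r ^ 2) (k₁ r) r)
    (hl : ∀ r, HasDerivAt (fun r ↦ 1 / 4 * v r ^ 2) (l₁ r) r)
    {q : Total m} (hq : ‖q.1‖ < 1) (hh₀ : h q.2.2 ≠ 0) (hv₀ : v q.2.2 ≠ 0) {κ ν ρ : ℝ}
    (hκ : k₁ q.2.2 = 2 * h q.2.2 ^ 2 * κ) (hρ : 1 / 4 * v q.2.2 ^ 2 = 2 * h q.2.2 ^ 2 * ρ)
    (hν : l₁ q.2.2 = 4 * h q.2.2 ^ 2 * ρ * ν)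
    {j : Cn m → Cn m} (hj : ∀ x z, extD α q.1 x z = chMetric q.1 (j x) z) (u w : Total m) :
    christoffel (mu h v α) q u w =
      (chGamma q.1 u.1 w.1 + κ • (u.2.2 • w.1 + w.2.2 • u.1)
          + ρ • (vertForm α q w • j u.1 + vertForm α q u • j w.1),
        ν * (u.2.2 * vertForm α q w + w.2.2 * vertForm α q u)
          + 1 / 2 * (fderiv ℝ α q.1 u.1 w.1 + fderiv ℝ α q.1 w.1 u.1)
          - α q.1 (chGamma q.1 u.1 w.1 + κ • (u.2.2 • w.1 + w.2.2 • u.1)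
          + ρ • (vertForm α q w • j u.1 + vertForm α q u • j w.1)),
        -(h q.2.2 ^ 2 * κ * chMetric q.1 u.1 w.1
          + 2 * h q.2.2 ^ 2 * ρ * ν * (vertForm α q u * vertForm α q w))) := by
  refine christoffel_eq (eventually_isInvertible_mu hh hv hq hh₀ hv₀).self_of_nhds fun e ↦ ?_
  rw [christoffelLower_mu hh hv hα hk hl hq, mu_apply', hρ, hκ, hν]
  rw [vertForm_mk]
  simp only [map_add, map_smul, add_apply, smul_apply, smul_eq_mul, ← hj, extD]
  ring

set_option maxHeartbeats 2000000 in
-- Hypothesis `hF` is `∇dα = 0` at the point. The result depends on `α` only through `dα` and the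
-- vertical components: the symmetric part of `Dα`, which depends on the choice of `θ`, cancels.
theorem mu_riemann (hh : ContDiff ℝ ∞ h) (hv : ContDiff ℝ ∞ v)
    (hα : ContDiffOn ℝ ∞ α (Metric.ball 0 1))
    (hk : ∀ r, HasDerivAt (fun r ↦ h r ^ 2) (k₁ r) r)
    (hl : ∀ r, HasDerivAt (fun r ↦ 1 / 4 * v r ^ 2) (l₁ r) r)
    {q : Total m} (hq : ‖q.1‖ < 1) (hh₀ : h q.2.2 ≠ 0) (hv₀ : v q.2.2 ≠ 0) {k₂ l₂ κ ν ρ : ℝ}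
    (hk₁ : HasDerivAt k₁ k₂ q.2.2) (hl₁ : HasDerivAt l₁ l₂ q.2.2)
    (hκ : k₁ q.2.2 = 2 * h q.2.2 ^ 2 * κ) (hρ : 1 / 4 * v q.2.2 ^ 2 = 2 * h q.2.2 ^ 2 * ρ)
    (hν : l₁ q.2.2 = 4 * h q.2.2 ^ 2 * ρ * ν)
    {j : Cn m → Cn m} (hj : ∀ x z, extD α q.1 x z = chMetric q.1 (j x) z)
    (hF : ∀ ξ x y, fderiv ℝ (fderiv ℝ α) q.1 ξ x y - fderiv ℝ (fderiv ℝ α) q.1 ξ y x =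
      extD α q.1 (chGamma q.1 ξ x) y + extD α q.1 x (chGamma q.1 ξ y))
    {x y : Cn m} {a b s t : ℝ} {u w : Total m} (hux : u.1 = x) (hwy : w.1 = y)
    (hua : vertForm α q u = a) (hwb : vertForm α q w = b) (hus : u.2.2 = s) (hwt : w.2.2 = t) :
    mu h v α q (riemann (mu h v α) q u w w) u =
      -(h q.2.2 ^ 2 * (chMetric q.1 x x * chMetric q.1 y y - chMetric q.1 x y ^ 2
            + 3 * chMetric q.1 (Complex.I • x) y ^ 2)
        + 3 / 2 * h q.2.2 ^ 2 * ρ * extD α q.1 x y ^ 2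
        + h q.2.2 ^ 4 * κ ^ 2 * (chMetric q.1 x x * chMetric q.1 y y - chMetric q.1 x y ^ 2)
        + 2 * h q.2.2 ^ 4 * ρ * κ * ν
          * chMetric q.1 (a • y - b • x) (a • y - b • x)
        - h q.2.2 ^ 2 * ρ ^ 2 * chMetric q.1 (a • j y - b • j x) (a • j y - b • j x)
        + (k₂ / 2 - h q.2.2 ^ 2 * κ ^ 2) * chMetric q.1 (s • y - t • x) (s • y - t • x)
        + (l₂ / 2 - 2 * h q.2.2 ^ 2 * ρ * ν ^ 2) * (s * b - t * a) ^ 2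
        + 6 * h q.2.2 ^ 2 * ρ * (ν - κ) * extD α q.1 x y * (s * b - t * a)) := by
  have hs := mu_comm h v α
  have hg : ContDiffAt ℝ 2 (mu h v α) q :=
    ((contDiffOn_mu hh hv hα).contDiffAt (tube_mem_nhds hq)).of_le two_le_infty
  have hsymm : IsSymmSndFDerivAt ℝ α q.1 :=
    (hα.contDiffAt (ball_mem_nhds hq)).isSymmSndFDerivAt (by simpa using two_le_infty)
  rw [apply_riemann hs hg (eventually_isInvertible_mu hh hv hq hh₀ hv₀)
    (hasDerivAt_christoffelLower_mu hh hv hα hk hl hq hk₁ hl₁ u w w u)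
    (hasDerivAt_christoffelLower_mu hh hv hα hk hl hq hk₁ hl₁ w u w u)]
  simp only [christoffel_mu hh hv hα hk hl hq hh₀ hv₀ hκ hρ hν hj]
  simp only [mu_apply', hρ, hκ, hν, hux, hwy, hua, hwb, hus, hwt]
  simp only [vertForm_mk]
  have hR := chMetric_curvature hq x y
  have hF1 := hF x y x
  have hF2 := hF y y x
  rw [hsymm y x] at hF2
  rw [hsymm y x]
  -- From here on `Dα(x, y)` and `⟨j x, y⟩` are the only mixed first-order data of `α`, so the
  -- cancellation becomes polynomial.
  have hD : fderiv ℝ α q.1 y x = fderiv ℝ α q.1 x y - chMetric q.1 (j x) y := by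
    rw [← hj, extD]; ring
  have hjs : ∀ a b, chMetric q.1 (j a) b = - chMetric q.1 (j b) a := fun a b ↦ by
    rw [← hj, ← hj, extD, extD]; ring
  have hjx : chMetric q.1 (j x) x = 0 := by linarith [hjs x x]
  have hjy : chMetric q.1 (j y) y = 0 := by linarith [hjs y y]
  have hjyx := hjs y x
  simp only [map_add, map_sub, map_smul, add_apply, sub_apply, smul_apply, smul_eq_mul] at hR ⊢
  simp only [hj] at hF1 hF2 ⊢
  rw [chGamma_comm q.1 y x] at hF2 ⊢
  rw [hjs (chGamma q.1 x y) x] at hF1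
  rw [hjs (chGamma q.1 y y) x] at hF2
  simp only [hD, hjx, hjy, hjyx, chMetric_comm q.1 y x, chMetric_comm q.1 (j y) (j x),
    chMetric_comm q.1 y (j x), chMetric_comm q.1 y (j y), chMetric_comm q.1 x (j x),
    chMetric_comm q.1 x (j y), chMetric_comm q.1 (chGamma q.1 _ _) (j _),
    chMetric_comm q.1 y (chGamma q.1 _ _), chMetric_comm q.1 x (chGamma q.1 _ _),
    chMetric_comm q.1 (chGamma q.1 y y) (chGamma q.1 x x)]
  linear_combination h q.2.2 ^ 2 * hR + 2 * h q.2.2 ^ 2 * ρ * b * hF1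
    - 2 * h q.2.2 ^ 2 * ρ * a * hF2

end TotalCurvature

/-! ### Consequences of the structure constants -/

section Frame

variable {m : ℕ}

theorem sum_chMetric_smul {p : Cn m} {e : Fin m × Fin 2 → Cn m}
    (he : ∀ i j, chMetric p (e i) (e j) = if i = j then 1 else 0) (x : Cn m) :
    x = ∑ i, chMetric p x (e i) • e i := by
  have hco : ∀ (a : Fin m × Fin 2 → ℝ) i, chMetric p (∑ l, a l • e l) (e i) = a i := by
    intro a i
    simp [he]
  have hli : LinearIndependent ℝ e := by
    rw [Fintype.linearIndependent_iff]
    intro a ha i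
    rw [← hco a i, ha]
    simp
  have hcard : Fintype.card (Fin m × Fin 2) = Module.finrank ℝ (Cn m) := by
    rw [finrank_real_of_complex, finrank_euclideanSpace]
    simp [mul_comm]
  have hx : x ∈ Submodule.span ℝ (Set.range e) := by
    rw [hli.span_eq_top_of_card_eq_finrank' hcard]
    trivial
  obtain ⟨a, rfl⟩ := (Submodule.mem_span_range_iff_exists_fun ℝ).mp hx
  simp only [hco]

theorem IsHolomorphicFrame.differentiableAt {p : Cn m} {X : Fin m × Fin 2 → Cn m → Cn m}
    (hX : IsHolomorphicFrame p X) : ∀ᶠ z in 𝓝 p, ∀ i, DifferentiableAt ℝ (X i) z := by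
  rw [Filter.eventually_all]
  intro i
  have h1 : ContDiffAt ℝ (1 : ℕ) (X i) p := contDiffAt_infty.1 (hX.smooth i) 1
  filter_upwards [h1.eventually (by simp)] with z hz
  exact hz.differentiableAt (by simp)

/-- The covariant derivative of a holomorphic frame vanishes at the base point. -/
theorem IsHolomorphicFrame.fderiv_eq {p : Cn m} (hp : ‖p‖ < 1) {X : Fin m × Fin 2 → Cn m → Cn m}
    (hX : IsHolomorphicFrame p X) (i : Fin m × Fin 2) (ξ : Cn m) :
    fderiv ℝ (X i) p ξ = -chGamma p ξ (X i p) := by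
  have he := hX.orthonormal.self_of_nhds
  have hd := hX.differentiableAt.self_of_nhds
  have hcompat : ∀ ξ i l, chMetric p (chGamma p ξ (X i p) + fderiv ℝ (X i) p ξ) (X l p)
      + chMetric p (X i p) (chGamma p ξ (X l p) + fderiv ℝ (X l) p ξ) = 0 := by
    intro ξ i l
    have h1 := hasDerivAt_chMetric hp ξ (hasDerivAt_comp_line (hd i) ξ)
      (hasDerivAt_comp_line (hd l) ξ)
    have hline : Filter.Tendsto (fun s : ℝ ↦ p + s • ξ) (𝓝 0) (𝓝 p) := by
      have : Continuous (fun s : ℝ ↦ p + s • ξ) := by fun_prop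
      simpa using this.tendsto 0
    have h2 := (hasDerivAt_const (0 : ℝ) (if i = l then (1 : ℝ) else 0)).congr_of_eventuallyEq
      (hline.eventually (hX.orthonormal.mono fun z hz ↦ hz i l))
    simpa using h1.unique h2
  have hsymm : ∀ i l, chGamma p (X i p) (X l p) + fderiv ℝ (X l) p (X i p) =
      chGamma p (X l p) (X i p) + fderiv ℝ (X i) p (X l p) := by
    intro i l
    have := hX.bracket i l
    rw [VectorField.lieBracket, sub_eq_zero] at this
    rw [this, chGamma_comm]
  -- The covariant derivatives `⟨∇_{X i} X l, X n⟩` are symmetric in `i, l` (no torsion, vanishing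
  -- brackets) and skew in `l, n` (orthonormality). Such an array vanishes, as in the uniqueness of
  -- the Levi-Civita connection.
  have hzero : ∀ i l n,
      chMetric p (chGamma p (X i p) (X l p) + fderiv ℝ (X l) p (X i p)) (X n p) = 0 := by
    intro i l n
    have h1 := hcompat (X i p) l n
    have h2 := hcompat (X l p) n i
    have h3 := hcompat (X n p) i l
    rw [chMetric_comm p (X l p)] at h1
    rw [chMetric_comm p (X n p)] at h2
    rw [chMetric_comm p (X i p)] at h3
    rw [hsymm l n, hsymm l i] at h2
    rw [hsymm n i] at h3
    linarith
  have hzero' : ∀ i l, chGamma p (X i p) (X l p) + fderiv ℝ (X l) p (X i p) = 0 := by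
    intro i l
    rw [sum_chMetric_smul he (chGamma p (X i p) (X l p) + fderiv ℝ (X l) p (X i p))]
    simp only [hzero, zero_smul, Finset.sum_const_zero]
  have hlin : ∀ (a : Fin m × Fin 2 → ℝ), chGamma p (∑ l, a l • X l p) (X i p)
      = ∑ l, a l • chGamma p (X l p) (X i p) := by
    intro a
    simp only [chGamma, inner_sum, ← Complex.coe_smul, inner_smul_right]
    simp only [smul_add, Finset.sum_smul, Finset.smul_sum, Finset.sum_add_distrib, smul_smul]
    congr 1 <;> refine Finset.sum_congr rfl fun l _ ↦ ?_ <;> ring_nf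
  rw [sum_chMetric_smul he ξ, hlin, map_sum, ← Finset.sum_neg_distrib]
  refine Finset.sum_congr rfl fun l _ ↦ ?_
  rw [map_smul, ← smul_neg, eq_neg_of_add_eq_zero_right (hzero' l i)]

theorem fderiv_horLift {α : Cn m → Cn m →L[ℝ] ℝ} {X : Cn m → Cn m} {y : Total m}
    (hα : DifferentiableAt ℝ α y.1) (hX : DifferentiableAt ℝ X y.1) (w : Total m) :
    fderiv ℝ (horLift α X) y w = (fderiv ℝ X y.1 w.1,
      -(fderiv ℝ α y.1 w.1 (X y.1) + α y.1 (fderiv ℝ X y.1 w.1)), 0) := by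
  have h1 : HasFDerivAt (fun y : Total m ↦ y.1) (ContinuousLinearMap.fst ℝ (Cn m) (ℝ × ℝ)) y :=
    hasFDerivAt_fst
  have hX' := hX.hasFDerivAt.comp y h1
  have hα' := HasFDerivAt.comp (F := Cn m) (G := Cn m →L[ℝ] ℝ) y hα.hasFDerivAt h1
  have h2 := hX'.prodMk ((hα'.clm_apply hX').neg.prodMk (hasFDerivAt_const (0 : ℝ) y))
  have h3 : HasFDerivAt (horLift α X) _ y := h2
  rw [h3.fderiv]
  simp [add_comm]

/-- Cartan's formula for `dθ + α` on horizontal fields. The sign makes `dα = -c k` on each pair,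
which is harmless since only `c k ^ 2` is used. -/
theorem vertForm_lieBracket_horLift {α : Cn m → Cn m →L[ℝ] ℝ} {X Y : Cn m → Cn m} {y : Total m}
    (hα : DifferentiableAt ℝ α y.1) (hX : DifferentiableAt ℝ X y.1)
    (hY : DifferentiableAt ℝ Y y.1) :
    vertForm α y (VectorField.lieBracket ℝ (horLift α X) (horLift α Y) y) =
      -extD α y.1 (X y.1) (Y y.1) := by
  rw [VectorField.lieBracket, map_sub, fderiv_horLift hα hX, fderiv_horLift hα hY,
    vertForm_apply, vertForm_apply, extD]
  simp only [horLift]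
  ring

theorem extD_add_left (α : Cn m → Cn m →L[ℝ] ℝ) (z x x' y : Cn m) :
    extD α z (x + x') y = extD α z x y + extD α z x' y := by
  simp only [extD, map_add, add_apply]; ring

theorem extD_smul_left (α : Cn m → Cn m →L[ℝ] ℝ) (z x y : Cn m) (a : ℝ) :
    extD α z (a • x) y = a * extD α z x y := by
  simp only [extD, map_smul, smul_apply, smul_eq_mul]; ring

theorem extD_swap (α : Cn m → Cn m →L[ℝ] ℝ) (z x y : Cn m) :
    extD α z x y = -extD α z y x := by
  simp only [extD]; ring

/-- `extD` as a bilinear form. -/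
def extDBilin (α : Cn m → Cn m →L[ℝ] ℝ) (z : Cn m) : Cn m →ₗ[ℝ] Cn m →ₗ[ℝ] ℝ :=
  LinearMap.mk₂ ℝ (extD α z) (fun x x' y ↦ extD_add_left α z x x' y)
    (fun a x y ↦ by rw [extD_smul_left, smul_eq_mul])
    (fun x y y' ↦ by rw [extD_swap, extD_add_left, extD_swap α z x y, extD_swap α z x y']; ring)
    (fun a x y ↦ by rw [extD_swap, extD_smul_left, extD_swap α z x y, smul_eq_mul]; ring)

theorem extDBilin_apply (α : Cn m → Cn m →L[ℝ] ℝ) (z x y : Cn m) :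
    extDBilin α z x y = extD α z x y := rfl

section

variable {α : Cn m → Cn m →L[ℝ] ℝ} {p : Cn m} {θ r : ℝ} {X : Fin m × Fin 2 → Cn m → Cn m}
  {c : Fin m → ℝ}

theorem HasStructureConstants.extD_pair (hα : ContDiffOn ℝ ∞ α (Metric.ball 0 1)) (hp : ‖p‖ < 1)
    (hX : IsHolomorphicFrame p X) (hc : HasStructureConstants α (p, θ, r) X c) (k : Fin m) :
    extD α p (X (k, 0) p) (X (k, 1) p) = -c k := by
  have hd := hX.differentiableAt.self_of_nhds
  have hdα : DifferentiableAt ℝ α p :=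
    (hα.contDiffAt (ball_mem_nhds hp)).differentiableAt (by simp)
  have h1 := vertForm_lieBracket_horLift (y := (p, θ, r)) hdα (hd (k, 0)) (hd (k, 1))
  rw [hc.pair k] at h1
  simp [vertForm_apply, dTheta] at h1
  linarith

theorem HasStructureConstants.extD_nonpair (hα : ContDiffOn ℝ ∞ α (Metric.ball 0 1))
    (hp : ‖p‖ < 1) (hX : IsHolomorphicFrame p X) (hc : HasStructureConstants α (p, θ, r) X c)
    {i l : Fin m × Fin 2} (hil : i.1 ≠ l.1) : extD α p (X i p) (X l p) = 0 := by
  have hd := hX.differentiableAt.self_of_nhds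
  have hdα : DifferentiableAt ℝ α p :=
    (hα.contDiffAt (ball_mem_nhds hp)).differentiableAt (by simp)
  have h1 := vertForm_lieBracket_horLift (y := (p, θ, r)) hdα (hd i) (hd l)
  rw [hc.nonpair i l hil, map_zero] at h1
  linarith

/-- The form `dα` is parallel at the base point. -/
theorem HasStructureConstants.fderiv_extD (hα : ContDiffOn ℝ ∞ α (Metric.ball 0 1))
    (hp : ‖p‖ < 1) (hX : IsHolomorphicFrame p X) (hc : HasStructureConstants α (p, θ, r) X c)
    (ξ x y : Cn m) :
    fderiv ℝ (fderiv ℝ α) p ξ x y - fderiv ℝ (fderiv ℝ α) p ξ y x =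
      extD α p (chGamma p ξ x) y + extD α p x (chGamma p ξ y) := by
  have hcα : ContDiffAt ℝ ∞ α p := hα.contDiffAt (ball_mem_nhds hp)
  have hddα : DifferentiableAt ℝ (fderiv ℝ α) p :=
    (hcα.fderiv_right (m := 1) (by norm_cast)).differentiableAt one_ne_zero
  have he := hX.orthonormal.self_of_nhds
  have hd := hX.differentiableAt.self_of_nhds
  have hframe : ∀ i l, fderiv ℝ (fderiv ℝ α) p ξ (X i p) (X l p)
      - fderiv ℝ (fderiv ℝ α) p ξ (X l p) (X i p) =
      extD α p (chGamma p ξ (X i p)) (X l p) + extD α p (X i p) (chGamma p ξ (X l p)) := by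
    intro i l
    have h1 := hasDerivAt_comp_line (F := Cn m →L[ℝ] Cn m →L[ℝ] ℝ) hddα ξ
    have hi := hasDerivAt_comp_line (hd i) ξ
    have hl := hasDerivAt_comp_line (hd l) ξ
    have h2 := ((h1.clm_apply hi).clm_apply hl).sub ((h1.clm_apply hl).clm_apply hi)
    have hline : HasDerivAt (fun s : ℝ ↦ ((p, θ, r) : Total m) + s • ((ξ, 0, 0) : Total m))
        (ξ, 0, 0) 0 := hasDerivAt_line _ _
    have h3 := (hc.constant i l).comp_hasDerivAt_of_eq (0 : ℝ) hline (by simp)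
    have hev : ∀ᶠ y : Total m in 𝓝 (p, θ, r),
        -vertForm α y (VectorField.lieBracket ℝ (horLift α (X i)) (horLift α (X l)) y) =
          extD α y.1 (X i y.1) (X l y.1) := by
      have hfst : Filter.Tendsto (fun y : Total m ↦ y.1) (𝓝 (p, θ, r)) (𝓝 p) :=
        continuous_fst.tendsto (p, θ, r)
      filter_upwards [hfst.eventually hX.differentiableAt,
        hfst.eventually (ball_mem_nhds hp)] with y hy1 hy2
      rw [vertForm_lieBracket_horLift
        ((hα.contDiffAt (ball_mem_nhds (by simpa using hy2))).differentiableAt (by simp))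
        (hy1 i) (hy1 l), neg_neg]
    have htend : Filter.Tendsto (fun s : ℝ ↦ ((p, θ, r) : Total m) + s • ((ξ, 0, 0) : Total m))
        (𝓝 0) (𝓝 (p, θ, r)) := by
      simpa using hline.continuousAt.tendsto
    have h4 := h3.neg.congr_of_eventuallyEq ((htend.eventually hev).mono fun s hs ↦ hs.symm)
    have h5 := h2.unique (h4.congr_of_eventuallyEq (.of_forall fun s ↦ by simp [extD]))
    -- `h5` says that `dα(X i, X l)` has zero derivative along `ξ`; parallelism of the frame turns
    -- each `D X` into `-chGamma`.
    simp [hX.fderiv_eq hp] at h5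
    simp only [extD]
    linarith
  let L : Cn m →ₗ[ℝ] Cn m :=
    { toFun := chGamma p ξ
      map_add' := fun a b ↦ by
        simp only [chGamma, inner_add_right]
        module
      map_smul' := fun a b ↦ by
        simp only [chGamma, ← Complex.coe_smul, inner_smul_right, RingHom.id_apply]
        module }
  let D : Cn m →ₗ[ℝ] Cn m →ₗ[ℝ] ℝ := (fderiv ℝ (fderiv ℝ α) p ξ).toLinearMap₁₂
  -- `Q` is `∇_ξ dα` as a bilinear form, so its vanishing may be checked on the frame.
  let Q : Cn m →ₗ[ℝ] Cn m →ₗ[ℝ] ℝ := D - D.flip - (extDBilin α p).comp L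
    - (extDBilin α p).compl₂ L
  have hQ : ∀ x y, Q x y = fderiv ℝ (fderiv ℝ α) p ξ x y - fderiv ℝ (fderiv ℝ α) p ξ y x
      - extD α p (chGamma p ξ x) y - extD α p x (chGamma p ξ y) := fun x y ↦ rfl
  have hQ0 : Q x y = 0 := by
    rw [sum_chMetric_smul he x, sum_chMetric_smul he y]
    simp only [map_sum, map_smul, LinearMap.sum_apply, LinearMap.smul_apply]
    refine Finset.sum_eq_zero fun i _ ↦ ?_
    refine smul_eq_zero_of_right _ (Finset.sum_eq_zero fun l _ ↦ smul_eq_zero_of_right _ ?_)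
    rw [hQ, hframe]
    ring
  rw [hQ] at hQ0
  linarith

/-- The skew operator which represents `dα` with respect to the complex hyperbolic metric is bounded
by the structure constants. -/
theorem HasStructureConstants.exists_skew (hα : ContDiffOn ℝ ∞ α (Metric.ball 0 1))
    (hp : ‖p‖ < 1) (hX : IsHolomorphicFrame p X) (hc : HasStructureConstants α (p, θ, r) X c)
    {K : ℝ} (hK : ∀ k, c k ^ 2 ≤ K) :
    ∃ j : Cn m →ₗ[ℝ] Cn m, (∀ x z, extD α p x z = chMetric p (j x) z) ∧
      ∀ x, chMetric p (j x) (j x) ≤ K * chMetric p x x := by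
  have he := hX.orthonormal.self_of_nhds
  let j : Cn m →ₗ[ℝ] Cn m := ∑ i, ((extDBilin α p).flip (X i p)).smulRight (X i p)
  have hjx : ∀ x, j x = ∑ i, extD α p x (X i p) • X i p := by
    intro x
    simp [j, extDBilin_apply]
  have hnorm : ∀ a : Fin m × Fin 2 → ℝ, chMetric p (∑ i, a i • X i p) (∑ i, a i • X i p) =
      ∑ k, (a (k, 0) ^ 2 + a (k, 1) ^ 2) := by
    intro a
    have : chMetric p (∑ i, a i • X i p) (∑ i, a i • X i p) = ∑ i, a i * a i := by
      simp [he]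
    rw [this, Fintype.sum_prod_type]
    simp [Fin.sum_univ_two, sq]
  refine ⟨j, fun x z ↦ ?_, fun x ↦ ?_⟩
  · rw [hjx]
    conv_lhs => rw [sum_chMetric_smul he z, ← extDBilin_apply]
    simp only [map_sum, map_smul, sum_apply, smul_apply, smul_eq_mul]
    refine Finset.sum_congr rfl fun i _ ↦ ?_
    rw [extDBilin_apply, chMetric_comm p z, mul_comm]
  · rw [hjx, hnorm]
    have hx := hnorm fun i ↦ chMetric p x (X i p)
    rw [← sum_chMetric_smul he x] at hx
    rw [hx, Finset.mul_sum]
    refine Finset.sum_le_sum fun k _ ↦ ?_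
    -- Block diagonality: only the two frame vectors of the pair of `i` contribute.
    have hcoef : ∀ i, extD α p x (X i p) =
        chMetric p x (X (i.1, 0) p) * extD α p (X (i.1, 0) p) (X i p)
          + chMetric p x (X (i.1, 1) p) * extD α p (X (i.1, 1) p) (X i p) := by
      intro i
      conv_lhs => rw [sum_chMetric_smul he x, ← extDBilin_apply]
      simp only [map_sum, map_smul, LinearMap.sum_apply, LinearMap.smul_apply, smul_eq_mul,
        extDBilin_apply]
      rw [Fintype.sum_prod_type, Finset.sum_eq_single i.1]
      · simp [Fin.sum_univ_two]
      · intro l _ hl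
        refine Finset.sum_eq_zero fun n _ ↦ ?_
        rw [hc.extD_nonpair hα hp hX (i := (l, n)) hl, mul_zero]
      · simp
    have h0 : ∀ x, extD α p x x = 0 := fun x ↦ by simp [extD]
    rw [hcoef (k, 0), hcoef (k, 1)]
    simp only [h0]
    rw [extD_swap α p (X (k, 1) p) (X (k, 0) p), hc.extD_pair hα hp hX k]
    have := mul_le_mul_of_nonneg_right (hK k)
      (by positivity : 0 ≤ chMetric p x (X (k, 0) p) ^ 2 + chMetric p x (X (k, 1) p) ^ 2)
    linarith

end

end Frame

/-! ### Pinching -/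

section Pinching

/-- Here `s = 1/cosh² r`, and `4T` bounds `|j|²`. At `s = 0`, `T = 1` both bounds hold without
error; `hε₁` pays for the error at `-1` and `hε₂` for that at `-4`. -/
theorem pinching_aux {W s F p q B z O T ε : ℝ} (hs₀ : 0 ≤ s)
    (hT₂ : T ≤ 2) (hp : 0 ≤ p) (hq : 0 ≤ q) (hz : 0 ≤ z)
    (hO : O ^ 2 ≤ W) (hF : F ^ 2 ≤ 4 * T * W) (hqp : q ≤ 4 * T * p) (hFB : (F * B) ^ 2 ≤ q * z)
    (hT₁ : 1 ≤ T) (hε₁ : 7 * s + (T - 1) < ε) (hε₂ : 3 * (T - 1) + 3 * s < ε)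
    (hA : 0 < W + p + z + B ^ 2) :
    -(W + 3 * s * O ^ 2 + 3 / 4 * (1 - s) * F ^ 2 + (2 - s) * p - (1 - s) / 4 * q
      + 3 * (F * B) + z + 4 * B ^ 2) / (W + p + z + B ^ 2) ∈ Set.Ioo (-4 - ε) (-1 + ε) := by
  have hW : 0 ≤ W := (sq_nonneg O).trans hO
  have hB := sq_nonneg B
  have hTW : T * W ≤ 2 * W := mul_le_mul_of_nonneg_right hT₂ hW
  have hTp : T * p ≤ 2 * p := mul_le_mul_of_nonneg_right hT₂ hp
  -- AM–GM: `(FB)² ≤ qz = 4 (q/4) z ≤ (q/4 + z)²`. Used at the end `-4`.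
  have hAM : F * B ≤ q / 4 + z := by
    refine le_of_abs_le (abs_le_of_sq_le_sq ?_ (by positivity))
    nlinarith [sq_nonneg (q / 4 - z)]
  have m1 : s * O ^ 2 ≤ s * W := mul_le_mul_of_nonneg_left hO hs₀
  have m2 : s * F ^ 2 ≤ s * (4 * T * W) := mul_le_mul_of_nonneg_left hF hs₀
  have m2' : s * (T * W) ≤ s * (2 * W) := mul_le_mul_of_nonneg_left hTW hs₀
  have m3 : s * q ≤ s * (4 * T * p) := mul_le_mul_of_nonneg_left hqp hs₀
  have m3' : s * (T * p) ≤ s * (2 * p) := mul_le_mul_of_nonneg_left hTp hs₀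
  have m4 : 0 ≤ s * O ^ 2 := by positivity
  have m5 : 0 ≤ s * q := by positivity
  have m6 : 0 ≤ s * F ^ 2 := by positivity
  have m7 : 0 ≤ s * p := by positivity
  have m8 : 0 ≤ s * W := by positivity
  have m9 : 0 ≤ s * z := by positivity
  have m10 : 0 ≤ s * B ^ 2 := by positivity
  have t1 : 0 ≤ (T - 1) * W := mul_nonneg (by linarith) hW
  have t2 : 0 ≤ (T - 1) * p := mul_nonneg (by linarith) hp
  have t3 : 0 ≤ (T - 1) * z := mul_nonneg (by linarith) hz
  have t4 : 0 ≤ (T - 1) * B ^ 2 := mul_nonneg (by linarith) hB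
  -- Used at the end `-1`, where `¾F² + 3FB + 3B² = 3(B + F/2)²`.
  have hsq := sq_nonneg (B + F / 2)
  constructor
  · rw [lt_div_iff₀ hA]
    have := mul_lt_mul_of_pos_right hε₂ hA
    linarith
  · rw [div_lt_iff₀ hA]
    have := mul_lt_mul_of_pos_right hε₁ hA
    linarith

variable {m : ℕ}

theorem chMetric_cauchySchwarz {p : Cn m} (hp : ‖p‖ < 1) (x y : Cn m) :
    chMetric p x y ^ 2 ≤ chMetric p x x * chMetric p y y :=
  LinearMap.BilinForm.apply_sq_le_of_symm (chMetric p).toLinearMap₁₂ (chMetric_self_nonneg hp)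
    ⟨fun x y ↦ chMetric_comm p x y⟩ x y

/-- Since `j x ⊥ x`, Cauchy–Schwarz may be applied to `j x` and a multiple of the component of `y`
orthogonal to `x`. It serves both for the operator of `dα` and for multiplication by `I`. -/
theorem chMetric_skew_sq_le {p : Cn m} (hp : ‖p‖ < 1) {j : Cn m → Cn m} {K : ℝ}
    (hskew : ∀ x, chMetric p (j x) x = 0)
    (hK : ∀ x, chMetric p (j x) (j x) ≤ K * chMetric p x x) (x y : Cn m) :
    chMetric p (j x) y ^ 2 ≤
      K * (chMetric p x x * chMetric p y y - chMetric p x y ^ 2) := by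
  rcases eq_or_ne x 0 with rfl | hx
  -- `j` is not assumed linear here, so the vanishing at `x = 0` comes from the norm bound.
  · have h1 := chMetric_cauchySchwarz hp (j 0) y
    have h2 := mul_le_mul_of_nonneg_right (hK 0) (chMetric_self_nonneg hp y)
    simpa using h1.trans h2
  have hpos := chMetric_self_pos hp hx
  have h1 := chMetric_cauchySchwarz hp (j x) (chMetric p x x • y - chMetric p x y • x)
  have h2 := mul_le_mul_of_nonneg_right (hK x)
    (chMetric_self_nonneg hp (chMetric p x x • y - chMetric p x y • x))
  have h3 := h1.trans h2
  simp only [map_sub, map_smul, sub_apply, smul_apply, smul_eq_mul, hskew, mul_zero, sub_zero,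
    chMetric_comm p y x] at h3
  refine le_of_mul_le_mul_left ?_ (pow_pos hpos 2)
  linarith

theorem mu_gram_pos {h v : ℝ → ℝ} (α : Cn m → Cn m →L[ℝ] ℝ) {q u w : Total m} (hq : ‖q.1‖ < 1)
    (hh : h q.2.2 ≠ 0) (hv : v q.2.2 ≠ 0) (hl : LinearIndependent ℝ ![u, w]) :
    0 < mu h v α q u u * mu h v α q w w - mu h v α q u w ^ 2 := by
  have hu : u ≠ 0 := hl.ne_zero 0
  have hpos := mu_self_pos α hq hh hv hu
  have he : mu h v α q u u • w - mu h v α q u w • u ≠ 0 := by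
    intro h0
    rw [LinearIndependent.pair_iff] at hl
    have := (hl (-mu h v α q u w) (mu h v α q u u) (by rw [← h0]; module)).2
    exact hpos.ne' this
  have h1 := mu_self_pos α hq hh hv he
  simp only [map_sub, map_smul, sub_apply, smul_apply, smul_eq_mul, mu_comm h v α q w u] at h1
  refine pos_of_mul_pos_right ?_ hpos.le
  linarith

theorem sectionalCurvature_mem {α : Cn m → Cn m →L[ℝ] ℝ} {q : Total m} {ε T : ℝ}
    (hα : ContDiffOn ℝ ∞ α (Metric.ball 0 1)) (hq : ‖q.1‖ < 1) (hr : 0 < q.2.2)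
    (hF : ∀ ξ x y, fderiv ℝ (fderiv ℝ α) q.1 ξ x y - fderiv ℝ (fderiv ℝ α) q.1 ξ y x =
      extD α q.1 (chGamma q.1 ξ x) y + extD α q.1 x (chGamma q.1 ξ y))
    {j : Cn m →ₗ[ℝ] Cn m} (hj : ∀ x z, extD α q.1 x z = chMetric q.1 (j x) z)
    (hjK : ∀ x, chMetric q.1 (j x) (j x) ≤ 4 * T * chMetric q.1 x x)
    (hT₁ : 1 ≤ T) (hT₂ : T ≤ 2) (hε₁ : 7 * (1 / Real.cosh q.2.2 ^ 2) + (T - 1) < ε)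
    (hε₂ : 3 * (T - 1) + 3 * (1 / Real.cosh q.2.2 ^ 2) < ε) {u w : Total m}
    (hl : LinearIndependent ℝ ![u, w]) :
    sectionalCurvature (mu Real.cosh (fun t ↦ Real.sinh (2 * t)) α) q u w
      ∈ Set.Ioo (-4 - ε) (-1 + ε) := by
  have hk : ∀ r, HasDerivAt (fun r ↦ Real.cosh r ^ 2) (2 * Real.cosh r * Real.sinh r) r := by
    intro r
    exact ((Real.hasDerivAt_cosh r).pow 2).congr_deriv (by simp)
  have h2 (r : ℝ) : HasDerivAt (fun r : ℝ ↦ 2 * r) 2 r := by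
    simpa using (hasDerivAt_id r).const_mul 2
  have hlr : ∀ r, HasDerivAt (fun r ↦ 1 / 4 * Real.sinh (2 * r) ^ 2)
      (Real.sinh (2 * r) * Real.cosh (2 * r)) r := by
    intro r
    refine (((h2 r).sinh.pow 2).const_mul (1 / 4)).congr_deriv ?_
    simp
    ring
  set C := Real.cosh q.2.2 with hC
  set S := Real.sinh q.2.2 with hS
  have hC0 : 0 < C := Real.cosh_pos _
  have hS0 : 0 < S := Real.sinh_pos_iff.mpr hr
  have hS2 : S ^ 2 = C ^ 2 - 1 := Real.sinh_sq _
  have hk₁ : HasDerivAt (fun r ↦ 2 * Real.cosh r * Real.sinh r) (2 * (C ^ 2 + S ^ 2)) q.2.2 := by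
    refine (((Real.hasDerivAt_cosh _).const_mul 2).mul (Real.hasDerivAt_sinh _)).congr_deriv ?_
    rw [← hC, ← hS]
    ring
  have hl₁ : HasDerivAt (fun r ↦ Real.sinh (2 * r) * Real.cosh (2 * r))
      (2 * ((C ^ 2 + S ^ 2) ^ 2 + 4 * C ^ 2 * S ^ 2)) q.2.2 := by
    refine ((h2 _).sinh.mul (h2 _).cosh).congr_deriv ?_
    rw [Real.sinh_two_mul, Real.cosh_two_mul, ← hC, ← hS]
    ring
  have hv₀ : Real.sinh (2 * q.2.2) ≠ 0 := (Real.sinh_pos_iff.mpr (by linarith)).ne'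
  have hD := mu_gram_pos (h := Real.cosh) (v := fun t ↦ Real.sinh (2 * t)) α hq hC0.ne' hv₀ hl
  have hR := mu_riemann (h := Real.cosh) (v := fun t ↦ Real.sinh (2 * t)) (κ := S / C) (ν := (C ^ 2 + S ^ 2) / (S * C)) (ρ := S ^ 2 / 2)
    Real.contDiff_cosh
    (Real.contDiff_sinh.comp (contDiff_const.mul contDiff_id) :
      ContDiff ℝ ∞ fun t ↦ Real.sinh (2 * t)) hα hk hlr hq
    hC0.ne' hv₀ hk₁ hl₁ (by rw [← hC, ← hS]; field_simp)
    (by simp only [Real.sinh_two_mul]; rw [← hC, ← hS]; ring)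
    (by rw [← hC, Real.sinh_two_mul, Real.cosh_two_mul, ← hC, ← hS]; field_simp; ring)
    hj hF (u := u) (w := w) rfl rfl rfl rfl rfl rfl
  have hjskew : ∀ x, chMetric q.1 (j x) x = 0 := fun x ↦ by rw [← hj, extD, sub_self]
  have hIskew : ∀ x, chMetric q.1 (Complex.I • x) x = 0 := fun x ↦ by
    have h1 := chMetric_I_smul_smul q.1 (Complex.I • x) x
    rw [smul_smul, Complex.I_mul_I, neg_one_smul, map_neg, neg_apply, chMetric_comm] at h1
    linarith
  have hjmap : ∀ a b : ℝ, a • j w.1 - b • j u.1 = j (a • w.1 - b • u.1) := fun a b ↦ by simp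
  -- The metric is diagonal in horizontal, vertical and radial parts, so the Gram determinant splits
  -- by Lagrange's identity into `W + p + z + B²`.
  have hcD : mu Real.cosh (fun t ↦ Real.sinh (2 * t)) α q u u
        * mu Real.cosh (fun t ↦ Real.sinh (2 * t)) α q w w
        - mu Real.cosh (fun t ↦ Real.sinh (2 * t)) α q u w ^ 2 =
      C ^ 4 * (chMetric q.1 u.1 u.1 * chMetric q.1 w.1 w.1 - chMetric q.1 u.1 w.1 ^ 2)
        + C ^ 4 * S ^ 2 * chMetric q.1 (vertForm α q u • w.1 - vertForm α q w • u.1)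
          (vertForm α q u • w.1 - vertForm α q w • u.1)
        + C ^ 2 * chMetric q.1 (u.2.2 • w.1 - w.2.2 • u.1) (u.2.2 • w.1 - w.2.2 • u.1)
        + (C * S * (u.2.2 * vertForm α q w - w.2.2 * vertForm α q u)) ^ 2 := by
    simp only [mu_apply', Real.sinh_two_mul, ← hC, ← hS, map_sub, map_smul, sub_apply, smul_apply,
      smul_eq_mul, chMetric_comm q.1 w.1 u.1]
    ring
  have hFB : (extD α q.1 u.1 w.1 * (u.2.2 * vertForm α q w - w.2.2 * vertForm α q u)) ^ 2 ≤
      chMetric q.1 (j (vertForm α q u • w.1 - vertForm α q w • u.1))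
          (j (vertForm α q u • w.1 - vertForm α q w • u.1))
        * chMetric q.1 (u.2.2 • w.1 - w.2.2 • u.1) (u.2.2 • w.1 - w.2.2 • u.1) := by
    -- By skewness `⟨j(ay - bx), sy - tx⟩ = -(sb - ta) dα(x, y)`.
    refine le_of_eq_of_le ?_ (chMetric_cauchySchwarz hq _ _)
    have h3 : chMetric q.1 (j w.1) u.1 = -chMetric q.1 (j u.1) w.1 := by
      rw [← hj, ← hj, extD_swap]
    simp only [map_sub, map_smul, sub_apply, smul_apply, smul_eq_mul, hjskew, h3, hj]
    ring
  have hFW := chMetric_skew_sq_le hq hjskew hjK u.1 w.1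
  have hOW := chMetric_skew_sq_le hq (K := 1) hIskew
    (fun x ↦ by rw [chMetric_I_smul_smul, one_mul]) u.1 w.1
  have hqp := hjK (vertForm α q u • w.1 - vertForm α q w • u.1)
  have hp0 := chMetric_self_nonneg hq (vertForm α q u • w.1 - vertForm α q w • u.1)
  have hq0 := chMetric_self_nonneg hq (j (vertForm α q u • w.1 - vertForm α q w • u.1))
  have hz0 := chMetric_self_nonneg hq (u.2.2 • w.1 - w.2.2 • u.1)
  rw [← hj] at hFW
  rw [hjmap, ← hC] at hR
  rw [sectionalCurvature, hR, hcD]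
  rw [hcD] at hD
  have key := pinching_aux (s := 1 / C ^ 2) (T := T) (ε := ε)
    (W := C ^ 4 * (chMetric q.1 u.1 u.1 * chMetric q.1 w.1 w.1 - chMetric q.1 u.1 w.1 ^ 2))
    (F := C ^ 2 * extD α q.1 u.1 w.1)
    (O := C ^ 2 * chMetric q.1 (Complex.I • u.1) w.1)
    (p := C ^ 4 * S ^ 2 * chMetric q.1 (vertForm α q u • w.1 - vertForm α q w • u.1)
          (vertForm α q u • w.1 - vertForm α q w • u.1))
    (q := C ^ 4 * S ^ 2 * chMetric q.1 (j (vertForm α q u • w.1 - vertForm α q w • u.1))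
          (j (vertForm α q u • w.1 - vertForm α q w • u.1)))
    (B := C * S * (u.2.2 * vertForm α q w - w.2.2 * vertForm α q u))
    (z := C ^ 2 * chMetric q.1 (u.2.2 • w.1 - w.2.2 • u.1) (u.2.2 • w.1 - w.2.2 • u.1))
    (by positivity) hT₂ (by positivity)
    (by positivity) (by positivity)
    (by linarith [mul_le_mul_of_nonneg_left hOW (by positivity : 0 ≤ C ^ 4)])
    (by linarith [mul_le_mul_of_nonneg_left hFW (by positivity : 0 ≤ C ^ 4)])
    (by linarith [mul_le_mul_of_nonneg_left hqp (by positivity : 0 ≤ C ^ 4 * S ^ 2)])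
    (by linarith [mul_le_mul_of_nonneg_left hFB (by positivity : 0 ≤ C ^ 6 * S ^ 2)])
    hT₁ hε₁ hε₂ hD
  convert key using 2
  -- `e1` to `e8` use `S² = C² - 1` to match the coefficients of `mu_riemann` with those of
  -- `pinching_aux` for `s = 1/C²`.
  have e1 : C ^ 2 + C ^ 4 * (S / C) ^ 2 = C ^ 4 := by
    field_simp
    rw [hS2]; ring
  have e2 : 3 / 2 * C ^ 2 * (S ^ 2 / 2) = 3 / 4 * (1 - 1 / C ^ 2) * C ^ 4 := by
    field_simp
    rw [hS2]; ring
  have e3 : 2 * C ^ 4 * (S ^ 2 / 2) * (S / C) * ((C ^ 2 + S ^ 2) / (S * C)) =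
      (2 - 1 / C ^ 2) * (C ^ 4 * S ^ 2) := by
    field_simp
    rw [hS2]; ring
  have e4 : C ^ 2 * (S ^ 2 / 2) ^ 2 = (1 - 1 / C ^ 2) / 4 * (C ^ 4 * S ^ 2) := by
    field_simp
    rw [hS2]; ring
  have e5 : 2 * (C ^ 2 + S ^ 2) / 2 - C ^ 2 * (S / C) ^ 2 = C ^ 2 := by
    field_simp
    ring
  have e6 : 2 * ((C ^ 2 + S ^ 2) ^ 2 + 4 * C ^ 2 * S ^ 2) / 2
      - 2 * C ^ 2 * (S ^ 2 / 2) * ((C ^ 2 + S ^ 2) / (S * C)) ^ 2 = 4 * (C * S) ^ 2 := by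
    field_simp
    ring
  have e7 : 6 * C ^ 2 * (S ^ 2 / 2) * ((C ^ 2 + S ^ 2) / (S * C) - S / C) = 3 * C ^ 3 * S := by
    field_simp
    ring
  have e8 : C ^ 2 = 1 / C ^ 2 * C ^ 4 := by field_simp
  rw [e2, e3, e4, e5, e6, e7]
  generalize chMetric q.1 u.1 u.1 * chMetric q.1 w.1 w.1 - chMetric q.1 u.1 w.1 ^ 2 = W at *
  linear_combination (-W) * e1 - 3 * chMetric q.1 (Complex.I • u.1) w.1 ^ 2 * e8

end Pinching

end PinchedCurvature

end

/-! ### Choice of `R` and `η` -/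

theorem lemma2p3 (m : ℕ) (ε : ℝ) (hε : 0 < ε) :
    ∃ R > (0 : ℝ), ∃ η > (0 : ℝ),
      ∀ (α : PinchedCurvature.Cn m → PinchedCurvature.Cn m →L[ℝ] ℝ),
        ContDiffOn ℝ ∞ α (Metric.ball 0 1) →
      ∀ (p : PinchedCurvature.Cn m) (θ r : ℝ), ‖p‖ < 1 → R < r →
      ∀ (X : Fin m × Fin 2 → PinchedCurvature.Cn m → PinchedCurvature.Cn m) (c : Fin m → ℝ),
        PinchedCurvature.IsHolomorphicFrame p X →
        PinchedCurvature.HasStructureConstants α (p, θ, r) X c →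
        (∀ k, c k ∈ Set.Ioo (-2 - η) (2 + η)) →
      ∀ A B : PinchedCurvature.Total m, LinearIndependent ℝ ![A, B] →
        PinchedCurvature.sectionalCurvature
          (PinchedCurvature.mu Real.cosh (fun t ↦ Real.sinh (2 * t)) α) (p, θ, r) A B
            ∈ Set.Ioo (-4 - ε) (-1 + ε) := by
  -- For `r > R` one has `cosh² r > r² > r > 16/ε`, so `s < ε/16`; and `η ≤ 1/2` gives `T - 1 = η +
  -- η²/4 ≤ 9η/8 ≤ 9ε/128`. Hence `7s + (T - 1)` and `3(T - 1) + 3s` are below `ε`.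
  refine ⟨1 + 16 / ε, by positivity, min (1 / 2) (ε / 16), by positivity, ?_⟩
  intro α hα p θ r hp hr X c hX hc hck A B hAB
  set η := min (1 / 2) (ε / 16) with hη
  have hη0 : 0 < η := by positivity
  have hη1 : η ≤ 1 / 2 := min_le_left _ _
  have hη2 : η ≤ ε / 16 := min_le_right _ _
  have hηsq : η ^ 2 ≤ η / 2 := by nlinarith
  have hr1 : 1 < r := by
    have : 0 < 16 / ε := by positivity
    linarith
  have hcosh : 16 / ε < Real.cosh r ^ 2 := by
    have h1 : r ≤ Real.sinh r := Real.self_le_sinh_iff.mpr (by linarith)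
    rw [Real.cosh_sq]
    nlinarith
  have hs : 1 / Real.cosh r ^ 2 < ε / 16 := by
    rw [one_div, inv_lt_comm₀ (by positivity) (by positivity), inv_div]
    exact hcosh
  -- The constant is `(2 + η)² = 4T` with `T = (1 + η/2)²`.
  obtain ⟨j, hj, hjK⟩ := hc.exists_skew hα hp hX (K := 4 * (1 + η + η ^ 2 / 4)) fun k ↦ by
    obtain ⟨h1, h2⟩ := hck k
    nlinarith
  exact PinchedCurvature.sectionalCurvature_mem (q := (p, θ, r)) (T := 1 + η + η ^ 2 / 4) hα hp
    (by change 0 < r; linarith) (hc.fderiv_extD hα hp hX) hj hjK (by nlinarith) (by nlinarith)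
    (by change 7 * (1 / Real.cosh r ^ 2) + _ < _; linarith)
    (by change _ + 3 * (1 / Real.cosh r ^ 2) < _; linarith) hAB
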